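/- Let $\mu$ be a Borel probability measure on $\mathbb{C}$ supported in the unit circle, i.e. $\mu(\{z\in\mathbb{C}:|z|=1\})=1$, and let $Z_1,Z_2,\dots$ be independent complex-valued random variables on a probability space $(\Omega,\mathbb{P})$, each with law $\mu$. For $\omega\in\Omega$ and $n\ge 1$ put $P_n(\omega)(z)=(z-Z_1(\omega))\cdots(z-Z_n(\omega))$. Fix an integer $k\ge 1$. For $n\ge k+1$ let $W_{n,1}(\omega),\dots,W_{n,n-k}(\omega)$ be the zeros, counted with multiplicity, of the $k$-th derivative $P_n(\omega)^{(k)}$, and let $$\mu_n^{(k)}(\omega)=\frac1{n-k}\sum_{j=1}^{n-k}\delta_{W_{n,j}(\omega)}$$ be their empirical measure. Then for $\mathbb{P}$-almost every $\omega$, the probability measures $\mu_n^{(k)}(\omega)$ converge weakly to $\mu$ as $n\to\infty$. -/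

import Mathlib

open MeasureTheory ProbabilityTheory Filter Topology Polynomial
open scoped ENNReal

/-- The monic polynomial `P_n(z) = (z - z₁)⋯(z - zₙ)` whose zeros are the first `n` terms of the
sequence `z` (whose terms are numbered from `0`). -/
noncomputable def polyOfZeros (z : ℕ → ℂ) (n : ℕ) : ℂ[X] :=
  ∏ i ∈ Finset.range n, (X - C (z i))

/-- The zeros, counted with multiplicity, of the `k`-th derivative of `P_n`. -/
noncomputable def derivZeros (k : ℕ) (z : ℕ → ℂ) (n : ℕ) : Multiset ℂ :=
  (derivative^[k] (polyOfZeros z n)).roots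

/-- The normalized counting measure `(n - k)⁻¹ ∑ δ_w` over the zeros `w`, counted with
multiplicity, of the `k`-th derivative of `P_n`. -/
noncomputable def derivZerosMeasure (k : ℕ) (z : ℕ → ℂ) (n : ℕ) : Measure ℂ :=
  ((n - k : ℕ) : ℝ≥0∞)⁻¹ • ((derivZeros k z n).map Measure.dirac).sum

theorem natDegree_polyOfZeros (z : ℕ → ℂ) (n : ℕ) : (polyOfZeros z n).natDegree = n := by
  simp [polyOfZeros]

theorem card_derivZeros (k : ℕ) (z : ℕ → ℂ) (n : ℕ) :
    Multiset.card (derivZeros k z n) = n - k := by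
  unfold derivZeros
  rw [← (IsAlgClosed.splits (derivative^[k] (polyOfZeros z n))).natDegree_eq_card_roots]
  induction k with
  | zero => simp [natDegree_polyOfZeros]
  | succ k ih => rw [Function.iterate_succ_apply', natDegree_derivative, ih, Nat.sub_sub]

theorem sum_map_dirac_univ (s : Multiset ℂ) :
    (s.map Measure.dirac).sum Set.univ = (Multiset.card s : ℝ≥0∞) := by
  induction s using Multiset.induction_on with
  | empty => simp
  | cons a s ih => simp [ih, add_comm]

theorem isProbabilityMeasure_derivZerosMeasure (k : ℕ) (z : ℕ → ℂ) (n : ℕ) (hkn : k < n) :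
    IsProbabilityMeasure (derivZerosMeasure k z n) := by
  constructor
  have h : ((n - k : ℕ) : ℝ≥0∞) ≠ 0 := by
    exact_mod_cast (Nat.sub_pos_of_lt hkn).ne'
  rw [derivZerosMeasure, Measure.smul_apply, sum_map_dirac_univ, card_derivZeros, smul_eq_mul]
  exact ENNReal.inv_mul_cancel h (ENNReal.natCast_ne_top _)

/-- The empirical measure, for `n ≥ k + 1`, of the `n - k` zeros of the `k`-th derivative of `P_n`,
as a point of the space of Borel probability measures on `ℂ` with the topology of weak
convergence. -/
noncomputable def empiricalMeasure (k : ℕ) (z : ℕ → ℂ) (n : ℕ) (hkn : k < n) :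
    ProbabilityMeasure ℂ :=
  ⟨derivZerosMeasure k z n, isProbabilityMeasure_derivZerosMeasure k z n hkn⟩

/-! By Gauss–Lucas all zeros of `P_n^(k)` stay in the closed disk, and by Stone–Weierstrass
(`tendsto_of_tendsto_moments`) weak convergence follows from two facts: the averages of `w ^ m`
converge to the moments of `μ`, and the average of `1 - ‖w‖ ^ 2` tends to 0.

Each differentiation changes every power sum of the zeros by `O(1)`
(`norm_sum_pow_roots_derivative_sub_le`, a contour integral of logarithmic derivatives), so the
strong law for `Z_i ^ m` gives the first fact.

For the second, fix `a` in the punctured disk and compare `a` with its reflection `1 / conj a`. For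
`P_n`, whose zeros lie on the circle, the moduli at the two points differ exactly by `‖a‖ ^ n`; each
zero of `P_n^(k)` inside the disk costs an extra factor. A bound `|P_n^(k)(a) / P_n(a)| ≥ c / n ^ p`
thus forces `∑ (1 - ‖w‖ ^ 2) = O(log n)` (`le_exp_neg_sum_derivZeros`).

The lower bound comes from a dichotomy. If the Cauchy transform of `μ` is nonzero at some `a`, the
ratio is asymptotic to `n ^ k` times the `k`-th power of that value. Otherwise the positive moments
of `μ` vanish, small arcs have small mass, and anti-concentration with Borel–Cantelli applies. -/

open scoped ComplexConjugate

/-! ### Differentiation and power sums of zeros. -/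

/-- Gauss–Lucas for the closed unit disk. -/
theorem norm_le_one_of_mem_roots_derivative {P : ℂ[X]} (h : ∀ w ∈ P.roots, ‖w‖ ≤ 1) :
    ∀ w ∈ (derivative P).roots, ‖w‖ ≤ 1 := by
  intro w hw
  have hD : derivative P ≠ 0 := by rintro h0; simp [h0] at hw
  have hP : P ≠ 0 := by rintro rfl; simp at hD
  have hdeg : 0 < P.degree := by
    by_contra hcon
    rw [eq_C_of_degree_le_zero (not_lt.mp hcon)] at hD
    simp at hD
  have h1 := rootSet_derivative_subset_convexHull_rootSet hdeg
    (show w ∈ (derivative P).rootSet ℂ by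
      rw [mem_rootSet]; exact ⟨hD, by simpa using (mem_roots hD).1 hw⟩)
  have h2 : P.rootSet ℂ ⊆ Metric.closedBall (0 : ℂ) 1 := by
    intro v hv
    rw [mem_rootSet] at hv
    simpa using h v ((mem_roots hP).2 (by simpa using hv.2))
  simpa using convexHull_min h2 (convex_closedBall (0 : ℂ) 1) h1

theorem norm_multiset_sum_map_le {ι : Type*} (s : Multiset ι) (f : ι → ℂ) (c : ℝ)
    (h : ∀ i ∈ s, ‖f i‖ ≤ c) : ‖(s.map f).sum‖ ≤ Multiset.card s * c := by
  induction s using Multiset.induction_on with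
  | empty => simp
  | cons a s ih =>
    simp only [Multiset.map_cons, Multiset.sum_cons, Multiset.card_cons, Nat.cast_add,
      Nat.cast_one]
    have h1 := ih fun i hi => h i (Multiset.mem_cons_of_mem hi)
    have h2 := h a (Multiset.mem_cons_self a s)
    linarith [norm_add_le (f a) (s.map f).sum]

theorem norm_one_div_sub_le {z w : ℂ} (hz : 1 < ‖z‖) (hw : ‖w‖ ≤ 1) :
    ‖1 / (z - w)‖ ≤ 1 / (‖z‖ - 1) := by
  rw [norm_div, norm_one]
  have := norm_sub_norm_le z w
  exact one_div_le_one_div_of_le (by linarith) (by linarith)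

/-- The real part equals `1/2 + (‖z‖² - ‖w‖²) / (2 ‖z - w‖²)`. It keeps `P'/P` from being small
outside the disk. -/
theorem half_le_re_div_sub {z w : ℂ} (hz : 1 < ‖z‖) (hw : ‖w‖ ≤ 1) :
    1 / 2 ≤ (z / (z - w)).re := by
  have h0 : 0 < ‖z - w‖ := by linarith [norm_sub_norm_le z w]
  have h1 : 0 < Complex.normSq (z - w) := by rw [Complex.normSq_eq_norm_sq]; positivity
  have hz2 : 1 ≤ z.re * z.re + z.im * z.im := by
    rw [← Complex.normSq_apply, Complex.normSq_eq_norm_sq]; nlinarith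
  have hw2 : w.re * w.re + w.im * w.im ≤ 1 := by
    rw [← Complex.normSq_apply, Complex.normSq_eq_norm_sq]; nlinarith [norm_nonneg w]
  rw [Complex.div_re, ← add_div, le_div_iff₀ h1, Complex.normSq_apply]
  simp only [Complex.sub_re, Complex.sub_im]
  nlinarith

theorem half_card_le_norm_mul_sum {z : ℂ} (hz : 1 < ‖z‖) (s : Multiset ℂ)
    (hs : ∀ w ∈ s, ‖w‖ ≤ 1) :
    (Multiset.card s : ℝ) / 2 ≤ ‖z‖ * ‖(s.map fun w => 1 / (z - w)).sum‖ := by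
  have key : (Multiset.card s : ℝ) / 2 ≤ (z * (s.map fun w => 1 / (z - w)).sum).re := by
    induction s using Multiset.induction_on with
    | empty => simp
    | cons a s ih =>
      have h1 := ih fun i hi => hs i (Multiset.mem_cons_of_mem hi)
      have h2 := half_le_re_div_sub hz (hs a (Multiset.mem_cons_self a s))
      simp only [Multiset.map_cons, Multiset.sum_cons, Multiset.card_cons, Nat.cast_add,
        Nat.cast_one, mul_add, Complex.add_re, mul_one_div] at h1 ⊢
      linarith
  rw [← norm_mul]
  exact key.trans (Complex.re_le_norm _)

theorem hasDerivAt_sum_one_div_sub (s : Multiset ℂ) (z : ℂ) (hs : ∀ w ∈ s, z ≠ w) :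
    HasDerivAt (fun x => (s.map fun w => 1 / (x - w)).sum)
      (-(s.map fun w => 1 / (z - w) ^ 2).sum) z := by
  induction s using Multiset.induction_on with
  | empty => simpa using hasDerivAt_const z (0 : ℂ)
  | cons a s ih =>
    have h1 := ih fun i hi => hs i (Multiset.mem_cons_of_mem hi)
    have h2 : z - a ≠ 0 := sub_ne_zero.2 (hs a (Multiset.mem_cons_self a s))
    have h3 : HasDerivAt (fun x => 1 / (x - a)) (-(1 / (z - a) ^ 2)) z := by
      have := ((hasDerivAt_id' z).sub_const a).fun_inv h2
      simpa [neg_div, div_eq_mul_inv] using this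
    simp only [Multiset.map_cons, Multiset.sum_cons, neg_add]
    exact h3.add h1

/-- With `u = P'/P`, both sides are `P''/P' - P'/P = u'/u`. -/
theorem sum_one_div_sub_roots_derivative {P : ℂ[X]} {z : ℂ} (h0 : P.eval z ≠ 0)
    (h1 : (derivative P).eval z ≠ 0) :
    ((derivative P).roots.map fun w => 1 / (z - w)).sum
        - (P.roots.map fun w => 1 / (z - w)).sum
      = -(P.roots.map fun w => 1 / (z - w) ^ 2).sum
        / (P.roots.map fun w => 1 / (z - w)).sum := by
  have hP : P ≠ 0 := by rintro rfl; simp at h0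
  have hd := hasDerivAt_sum_one_div_sub P.roots z (by
    rintro w hw rfl; exact h0 ((mem_roots hP).1 hw))
  have hq : HasDerivAt (fun x => (derivative P).eval x / P.eval x)
      (((derivative (derivative P)).eval z * P.eval z
        - (derivative P).eval z * (derivative P).eval z) / P.eval z ^ 2) z :=
    ((derivative P).hasDerivAt z).div (P.hasDerivAt z) h0
  have heq : (fun x => (derivative P).eval x / P.eval x) =ᶠ[𝓝 z]
      fun x => (P.roots.map fun w => 1 / (x - w)).sum := by
    filter_upwards [P.continuous.continuousAt.eventually_ne h0] with x hx
    exact (IsAlgClosed.splits _).eval_derivative_div_eval_of_ne_zero hx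
  have hu := (hd.congr_of_eventuallyEq heq).unique hq
  rw [hu, ← (IsAlgClosed.splits P).eval_derivative_div_eval_of_ne_zero h0,
    ← (IsAlgClosed.splits (derivative P)).eval_derivative_div_eval_of_ne_zero h1]
  field_simp

theorem continuousOn_pow_mul_one_div_sub (w : ℂ) (m : ℕ) (hw : ‖w‖ ≤ 1) :
    ContinuousOn (fun z : ℂ => z ^ m * (1 / (z - w))) (Metric.sphere 0 2) := by
  refine (continuous_pow m).continuousOn.mul (continuousOn_const.div (by fun_prop) ?_)
  intro z hz h
  have : ‖z‖ = 2 := by simpa using hz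
  rw [sub_eq_zero.1 h] at this
  linarith

theorem circleIntegral_pow_mul_sum_one_div_sub (s : Multiset ℂ) (m : ℕ)
    (hs : ∀ w ∈ s, ‖w‖ ≤ 1) :
    CircleIntegrable (fun z => z ^ m * (s.map fun w => 1 / (z - w)).sum) 0 2 ∧
    (∮ z in C(0, 2), z ^ m * (s.map fun w => 1 / (z - w)).sum)
      = 2 * Real.pi * Complex.I * (s.map fun w => w ^ m).sum := by
  induction s using Multiset.induction_on with
  | empty => simp [CircleIntegrable, circleIntegral]
  | cons a s ih =>
    have ha := hs a (Multiset.mem_cons_self a s)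
    obtain ⟨h1, h2⟩ := ih fun i hi => hs i (Multiset.mem_cons_of_mem hi)
    have h3 : CircleIntegrable (fun z : ℂ => z ^ m * (1 / (z - a))) 0 2 :=
      (continuousOn_pow_mul_one_div_sub a m ha).circleIntegrable (by norm_num)
    have h4 : (∮ z in C(0, 2), z ^ m * (1 / (z - a))) = 2 * Real.pi * Complex.I * a ^ m := by
      have := DiffContOnCl.circleIntegral_sub_inv_smul (c := (0 : ℂ)) (R := 2) (w := a)
        (f := fun z : ℂ => z ^ m) ((differentiable_pow m).diffContOnCl)
        (by simpa using ha.trans_lt (by norm_num))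
      simpa [mul_comm] using this
    simp only [Multiset.map_cons, Multiset.sum_cons, mul_add]
    exact ⟨h3.add h1, by rw [circleIntegral.integral_add h3 h1, h4, h2]⟩

/-- The point is that the bound does not depend on the degree: in `u'/u`, with `u = P'/P`, both `u'`
and `u` are of the order of the degree. -/
theorem norm_sum_pow_roots_derivative_sub_le {P : ℂ[X]} (hdeg : 0 < P.natDegree)
    (hP : ∀ w ∈ P.roots, ‖w‖ ≤ 1) (m : ℕ) :
    ‖((derivative P).roots.map fun w => w ^ m).sum - (P.roots.map fun w => w ^ m).sum‖
      ≤ 8 * 2 ^ m := by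
  have hP0 : P ≠ 0 := by rintro rfl; simp at hdeg
  have hcard : Multiset.card P.roots = P.natDegree :=
    (IsAlgClosed.splits P).natDegree_eq_card_roots.symm
  have hD := norm_le_one_of_mem_roots_derivative hP
  obtain ⟨i1, e1⟩ := circleIntegral_pow_mul_sum_one_div_sub _ m hD
  obtain ⟨i2, e2⟩ := circleIntegral_pow_mul_sum_one_div_sub _ m hP
  have hdiff : (∮ z in C(0, 2), (z ^ m * ((derivative P).roots.map fun w => 1 / (z - w)).sum
      - z ^ m * (P.roots.map fun w => 1 / (z - w)).sum))
      = 2 * Real.pi * Complex.I * (((derivative P).roots.map fun w => w ^ m).sum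
        - (P.roots.map fun w => w ^ m).sum) := by
    rw [circleIntegral.integral_sub i1 i2, e1, e2, mul_sub]
  -- On `‖z‖ = 2`, `‖u'‖` is at most the degree and `‖u‖` at least a quarter of it, hence the 4. The
  -- length `4π` over `2π` then gives `8 * 2 ^ m`.
  have hb := circleIntegral.norm_integral_le_of_norm_le_const (c := (0 : ℂ)) (R := 2)
    (C := 2 ^ m * 4) (f := fun z => z ^ m * ((derivative P).roots.map fun w => 1 / (z - w)).sum
      - z ^ m * (P.roots.map fun w => 1 / (z - w)).sum) (by norm_num) (by
    intro z hz
    have hz2 : ‖z‖ = 2 := by simpa using hz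
    have hz1 : 1 < ‖z‖ := by rw [hz2]; norm_num
    have h0 : P.eval z ≠ 0 := fun h => by
      have := hP z ((mem_roots hP0).2 h); linarith
    have hlow := half_card_le_norm_mul_sum hz1 P.roots hP
    have hS : (P.natDegree : ℝ) / 4 ≤ ‖(P.roots.map fun w => 1 / (z - w)).sum‖ := by
      rw [hz2, hcard] at hlow; linarith
    have hn : (0 : ℝ) < P.natDegree := by exact_mod_cast hdeg
    have h1 : (derivative P).eval z ≠ 0 := by
      intro h
      have := (IsAlgClosed.splits P).eval_derivative_div_eval_of_ne_zero h0
      rw [h, zero_div] at this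
      rw [← this, norm_zero] at hS
      linarith
    rw [← mul_sub, sum_one_div_sub_roots_derivative h0 h1, norm_mul, norm_pow, hz2, norm_div,
      norm_neg]
    have hup : ‖(P.roots.map fun w => 1 / (z - w) ^ 2).sum‖ ≤ Multiset.card P.roots * 1 := by
      refine norm_multiset_sum_map_le _ _ _ fun w hw => ?_
      have h3 := norm_one_div_sub_le hz1 (hP w hw)
      rw [hz2] at h3
      rw [← one_div_pow, norm_pow]
      exact pow_le_one₀ (norm_nonneg _) (by linarith)
    rw [hcard, mul_one] at hup
    refine mul_le_mul_of_nonneg_left ?_ (by positivity)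
    rw [div_le_iff₀ (by linarith)]
    linarith)
  rw [hdiff] at hb
  simp only [norm_mul, Complex.norm_I, Complex.norm_real, Complex.norm_ofNat, Real.norm_eq_abs,
    abs_of_pos Real.pi_pos, mul_one] at hb
  have := Real.pi_pos
  refine le_of_mul_le_mul_left (hb.trans_eq ?_) (by positivity : 0 < 2 * Real.pi)
  ring

theorem norm_eval_derivative_le {P : ℂ[X]} (hP0 : P ≠ 0) (hP : ∀ w ∈ P.roots, ‖w‖ ≤ 1) {u : ℂ}
    (hu : 1 < ‖u‖) :
    ‖(derivative P).eval u‖ ≤ ‖P.eval u‖ * (P.natDegree / (‖u‖ - 1)) := by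
  have h0 : P.eval u ≠ 0 := fun h => by
    have := hP u ((mem_roots hP0).2 h); linarith
  have h1 := (IsAlgClosed.splits P).eval_derivative_div_eval_of_ne_zero h0
  rw [div_eq_iff h0] at h1
  rw [h1, norm_mul, mul_comm]
  refine mul_le_mul_of_nonneg_left ?_ (norm_nonneg _)
  have h2 := norm_multiset_sum_map_le P.roots (fun w => 1 / (u - w)) _ fun w hw =>
    norm_one_div_sub_le hu (hP w hw)
  rwa [(IsAlgClosed.splits P).natDegree_eq_card_roots, div_eq_mul_one_div]

/-! ### Iterated derivatives of `P_n`. -/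

theorem roots_polyOfZeros (z : ℕ → ℂ) (n : ℕ) :
    (polyOfZeros z n).roots = (Finset.range n).val.map z := by
  have h : polyOfZeros z n = (((Finset.range n).val.map z).map fun a => X - C a).prod := by
    rw [polyOfZeros, Finset.prod, Multiset.map_map]; rfl
  rw [h, roots_multiset_prod_X_sub_C]

theorem natDegree_iterate_derivative_polyOfZeros (k : ℕ) (z : ℕ → ℂ) (n : ℕ) :
    (derivative^[k] (polyOfZeros z n)).natDegree = n - k := by
  rw [(IsAlgClosed.splits _).natDegree_eq_card_roots]
  exact card_derivZeros k z n

theorem derivZeros_succ (k : ℕ) (z : ℕ → ℂ) (n : ℕ) :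
    derivZeros (k + 1) z n = (derivative (derivative^[k] (polyOfZeros z n))).roots := by
  rw [derivZeros, Function.iterate_succ_apply']

section
variable {z : ℕ → ℂ} (hz : ∀ i, ‖z i‖ = 1)
include hz

theorem norm_le_one_of_mem_derivZeros (k n : ℕ) : ∀ w ∈ derivZeros k z n, ‖w‖ ≤ 1 := by
  induction k with
  | zero =>
    intro w hw
    rw [derivZeros, Function.iterate_zero_apply, roots_polyOfZeros, Multiset.mem_map] at hw
    obtain ⟨i, -, rfl⟩ := hw
    exact (hz i).le
  | succ k ih =>
    rw [derivZeros_succ]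
    exact norm_le_one_of_mem_roots_derivative ih

theorem norm_sum_pow_derivZeros_sub_le (m k n : ℕ) (hkn : k ≤ n) :
    ‖((derivZeros k z n).map fun w => w ^ m).sum - ∑ i ∈ Finset.range n, z i ^ m‖
      ≤ k * (8 * 2 ^ m) := by
  induction k with
  | zero => simp [derivZeros, roots_polyOfZeros, Finset.sum]
  | succ k ih =>
    have h1 := norm_sum_pow_roots_derivative_sub_le
      (P := derivative^[k] (polyOfZeros z n))
      (by rw [natDegree_iterate_derivative_polyOfZeros]; omega)
      (norm_le_one_of_mem_derivZeros hz k n) m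
    rw [← derivZeros_succ, ← derivZeros] at h1
    have h2 := ih (by omega)
    have h3 := norm_add_le _ _ |>.trans (add_le_add h1 h2)
    rw [sub_add_sub_cancel] at h3
    push_cast
    linarith

theorem norm_eval_iterate_derivative_le {u : ℂ} (hu : 1 < ‖u‖) (k n : ℕ) (hkn : k ≤ n) :
    ‖(derivative^[k] (polyOfZeros z n)).eval u‖
      ≤ ‖(polyOfZeros z n).eval u‖ * (n / (‖u‖ - 1)) ^ k := by
  induction k with
  | zero => simp
  | succ k ih =>
    have hne : derivative^[k] (polyOfZeros z n) ≠ 0 := by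
      intro h
      have := natDegree_iterate_derivative_polyOfZeros k z n
      rw [h, natDegree_zero] at this
      omega
    have h1 := norm_eval_derivative_le hne (norm_le_one_of_mem_derivZeros hz k n) hu
    rw [natDegree_iterate_derivative_polyOfZeros] at h1
    have hpos : 0 < ‖u‖ - 1 := by linarith
    have h2 : ((n - k : ℕ) : ℝ) / (‖u‖ - 1) ≤ n / (‖u‖ - 1) := by
      gcongr; omega
    rw [Function.iterate_succ_apply', pow_succ, ← mul_assoc]
    exact h1.trans (mul_le_mul (ih (by omega)) h2 (by positivity) (by positivity))

end

/-! ### Reflection in the circle and concentration of the zeros. -/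

/-- From `‖1 - conj a * w‖² - ‖a - w‖² = (1 - ‖a‖²)(1 - ‖w‖²)`. The 8 is `4 * 2`: `‖1 - conj a * w‖²
≤ 4`, and a square root is taken. -/
theorem norm_sub_le_norm_one_sub_conj_mul_exp {a w : ℂ} (ha : ‖a‖ < 1) (hw : ‖w‖ ≤ 1) :
    ‖a - w‖ ≤ ‖1 - conj a * w‖ * Real.exp (-((1 - ‖a‖ ^ 2) / 8 * (1 - ‖w‖ ^ 2))) := by
  have e1 : ‖a - w‖ ^ 2 = ‖1 - conj a * w‖ ^ 2 - (1 - ‖a‖ ^ 2) * (1 - ‖w‖ ^ 2) := by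
    simp only [← Complex.normSq_eq_norm_sq, Complex.normSq_apply, Complex.sub_re, Complex.sub_im,
      Complex.mul_re, Complex.mul_im, Complex.conj_re, Complex.conj_im, Complex.one_re,
      Complex.one_im]
    ring
  have ha2 : 0 ≤ 1 - ‖a‖ ^ 2 := by nlinarith [norm_nonneg a]
  have hw2 : 0 ≤ 1 - ‖w‖ ^ 2 := by nlinarith [norm_nonneg w]
  have e2 : ‖1 - conj a * w‖ ^ 2 ≤ 4 := by
    have : ‖1 - conj a * w‖ ≤ 1 + 1 := by
      refine (norm_sub_le _ _).trans ?_
      rw [norm_one, norm_mul, Complex.norm_conj]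
      nlinarith [norm_nonneg a, norm_nonneg w]
    nlinarith [norm_nonneg (1 - conj a * w)]
  set t := (1 - ‖a‖ ^ 2) * (1 - ‖w‖ ^ 2) with ht
  have ht0 : 0 ≤ t := mul_nonneg ha2 hw2
  have e3 : 1 - t / 4 ≤ Real.exp (-(t / 4)) := by
    have := Real.add_one_le_exp (-(t / 4)); linarith
  have e4 : Real.exp (-(t / 4)) = Real.exp (-((1 - ‖a‖ ^ 2) / 8 * (1 - ‖w‖ ^ 2))) ^ 2 := by
    rw [← Real.exp_nat_mul]; congr 1; rw [ht]; push_cast; ring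
  refine le_of_sq_le_sq ?_ (by positivity)
  rw [mul_pow, ← e4, e1]
  calc ‖1 - conj a * w‖ ^ 2 - t ≤ ‖1 - conj a * w‖ ^ 2 * (1 - t / 4) := by nlinarith
    _ ≤ _ := mul_le_mul_of_nonneg_left e3 (by positivity)

theorem prod_norm_sub_le {a : ℂ} (ha : ‖a‖ < 1) (s : Multiset ℂ) (hs : ∀ w ∈ s, ‖w‖ ≤ 1) :
    (s.map fun w => ‖a - w‖).prod ≤ (s.map fun w => ‖1 - conj a * w‖).prod
      * Real.exp (-((1 - ‖a‖ ^ 2) / 8 * (s.map fun w => 1 - ‖w‖ ^ 2).sum)) := by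
  induction s using Multiset.induction_on with
  | empty => simp
  | cons b s ih =>
    have h1 := ih fun i hi => hs i (Multiset.mem_cons_of_mem hi)
    have h2 := norm_sub_le_norm_one_sub_conj_mul_exp ha (hs b (Multiset.mem_cons_self b s))
    simp only [Multiset.map_cons, Multiset.prod_cons, Multiset.sum_cons, mul_add, neg_add,
      Real.exp_add]
    have h0 : 0 ≤ (s.map fun w => ‖a - w‖).prod :=
      Multiset.prod_nonneg (by simp only [Multiset.mem_map]; rintro _ ⟨w, -, rfl⟩; positivity)
    refine (mul_le_mul h2 h1 h0 (by positivity)).trans_eq ?_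
    ring

theorem prod_norm_one_sub_conj_mul_pos {a : ℂ} (ha : ‖a‖ < 1) (s : Multiset ℂ)
    (hs : ∀ w ∈ s, ‖w‖ ≤ 1) : 0 < (s.map fun w => ‖1 - conj a * w‖).prod := by
  refine Multiset.prod_pos ?_
  simp only [Multiset.mem_map]
  rintro _ ⟨w, hw, rfl⟩
  rw [norm_pos_iff, sub_ne_zero]
  intro h
  have h1 : ‖conj a * w‖ = 1 := by rw [← h, norm_one]
  rw [norm_mul, Complex.norm_conj] at h1
  nlinarith [hs w hw, norm_nonneg a, norm_nonneg w]

theorem norm_eval_eq_prod (P : ℂ[X]) (x : ℂ) :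
    ‖P.eval x‖ = ‖P.leadingCoeff‖ * (P.roots.map fun w => ‖x - w‖).prod := by
  rw [(IsAlgClosed.splits P).eval_eq_prod_roots, norm_mul]
  congr 1
  induction P.roots using Multiset.induction_on with
  | empty => simp
  | cons b s ih => simp [ih]

theorem norm_pow_mul_prod_norm_sub {a : ℂ} (ha : a ≠ 0) (s : Multiset ℂ) :
    ‖a‖ ^ Multiset.card s * (s.map fun w => ‖(conj a)⁻¹ - w‖).prod
      = (s.map fun w => ‖1 - conj a * w‖).prod := by
  induction s using Multiset.induction_on with
  | empty => simp
  | cons b s ih =>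
    have h : ‖1 - conj a * b‖ = ‖a‖ * ‖(conj a)⁻¹ - b‖ := by
      rw [← Complex.norm_conj a, ← norm_mul, mul_sub,
        mul_inv_cancel₀ ((_root_.map_ne_zero _).2 ha)]
    simp only [Multiset.map_cons, Multiset.prod_cons, Multiset.card_cons, ← ih, h]
    ring

theorem norm_pow_mul_norm_eval_inv_conj {a : ℂ} (ha : a ≠ 0) (P : ℂ[X]) :
    ‖a‖ ^ P.natDegree * ‖P.eval (conj a)⁻¹‖
      = ‖P.leadingCoeff‖ * (P.roots.map fun w => ‖1 - conj a * w‖).prod := by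
  rw [norm_eval_eq_prod, ← norm_pow_mul_prod_norm_sub ha,
    (IsAlgClosed.splits P).natDegree_eq_card_roots]
  ring

theorem norm_one_sub_conj_mul_of_norm_eq_one (a : ℂ) {w : ℂ} (hw : ‖w‖ = 1) :
    ‖1 - conj a * w‖ = ‖a - w‖ := by
  have h : conj w * w = 1 := by rw [Complex.conj_mul', hw]; simp
  rw [← h, ← sub_mul, norm_mul, hw, mul_one, ← map_sub, Complex.norm_conj, norm_sub_rev]

section
variable {z : ℕ → ℂ} (hz : ∀ i, ‖z i‖ = 1)
include hz

/-- Zeros on the circle have Blaschke factors of modulus 1, so nothing is lost here. -/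
theorem norm_pow_mul_norm_eval_polyOfZeros {a : ℂ} (ha : a ≠ 0) (n : ℕ) :
    ‖a‖ ^ n * ‖(polyOfZeros z n).eval (conj a)⁻¹‖ = ‖(polyOfZeros z n).eval a‖ := by
  have h := norm_pow_mul_norm_eval_inv_conj ha (polyOfZeros z n)
  rw [natDegree_polyOfZeros] at h
  rw [h, norm_eval_eq_prod (polyOfZeros z n) a]
  congr 2
  refine Multiset.map_congr rfl fun w hw => ?_
  rw [roots_polyOfZeros, Multiset.mem_map] at hw
  obtain ⟨i, -, rfl⟩ := hw
  exact norm_one_sub_conj_mul_of_norm_eq_one a (hz i)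

/-- Pass from `Q(a)`, `Q = P_n^(k)`, to `Q(1 / conj a)` at the cost of the exponential, then to
`P_n(1 / conj a)` by the growth bound outside the disk, then back to `P_n(a)` by exact reflection.
-/
theorem le_exp_neg_sum_derivZeros {a : ℂ} (ha0 : a ≠ 0) (ha1 : ‖a‖ < 1) {k n : ℕ} (hkn : k < n)
    {q : ℝ}
    (h : ‖(polyOfZeros z n).eval a‖ * q ≤ ‖(derivative^[k] (polyOfZeros z n)).eval a‖) :
    q * ‖a‖ ^ k * ((‖a‖⁻¹ - 1) / n) ^ k
      ≤ Real.exp (-((1 - ‖a‖ ^ 2) / 8 * ((derivZeros k z n).map fun w => 1 - ‖w‖ ^ 2).sum)) := by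
  by_cases hq : q ≤ 0
  · refine le_trans ?_ (Real.exp_pos _).le
    have : 1 ≤ ‖a‖⁻¹ := (one_le_inv₀ (norm_pos_iff.2 ha0)).2 ha1.le
    exact mul_nonpos_of_nonpos_of_nonneg (mul_nonpos_of_nonpos_of_nonneg hq (by positivity))
      (pow_nonneg (div_nonneg (by linarith) (by positivity)) _)
  push Not at hq
  have hapos : 0 < ‖a‖ := norm_pos_iff.2 ha0
  have hu : 1 < ‖(conj a)⁻¹‖ := by
    rw [norm_inv, Complex.norm_conj]; exact (one_lt_inv₀ hapos).2 ha1
  have hd : 0 < ‖a‖⁻¹ - 1 := by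
    rw [norm_inv, Complex.norm_conj] at hu; linarith
  have hn : (0 : ℝ) < n := by exact_mod_cast (by omega : 0 < n)
  set Q := derivative^[k] (polyOfZeros z n) with hQ
  have hdeg : Q.natDegree = n - k := natDegree_iterate_derivative_polyOfZeros k z n
  have hQ0 : Q ≠ 0 := by rintro h0; rw [h0, natDegree_zero] at hdeg; omega
  have hL : 0 < ‖Q.leadingCoeff‖ := norm_pos_iff.2 (leadingCoeff_ne_zero.2 hQ0)
  have hroots : ∀ w ∈ Q.roots, ‖w‖ ≤ 1 := norm_le_one_of_mem_derivZeros hz k n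
  have h1 := norm_pow_mul_norm_eval_inv_conj ha0 Q
  have h2 := norm_pow_mul_norm_eval_polyOfZeros hz ha0 n
  have h3 := norm_eval_iterate_derivative_le hz hu k n hkn.le
  have h4 := prod_norm_sub_le ha1 Q.roots hroots
  have h5 := prod_norm_one_sub_conj_mul_pos ha1 Q.roots hroots
  rw [norm_inv, Complex.norm_conj] at h3
  rw [← hQ] at h3
  rw [norm_eval_eq_prod Q, ← h2] at h
  rw [hdeg] at h1
  change _ ≤ Real.exp (-((1 - ‖a‖ ^ 2) / 8 * (Q.roots.map fun w => 1 - ‖w‖ ^ 2).sum))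
  set E := Real.exp (-((1 - ‖a‖ ^ 2) / 8 * (Q.roots.map fun w => 1 - ‖w‖ ^ 2).sum))
  set B := (Q.roots.map fun w => ‖1 - conj a * w‖).prod
  set L := ‖Q.leadingCoeff‖
  set d := ‖a‖⁻¹ - 1
  set p := ‖(polyOfZeros z n).eval (conj a)⁻¹‖
  have h6 : ‖Q.eval (conj a)⁻¹‖ * (d / n) ^ k ≤ p := by
    refine (mul_le_mul_of_nonneg_right h3 (by positivity)).trans_eq ?_
    rw [mul_assoc, ← mul_pow]
    have : (n : ℝ) / d * (d / n) = 1 := by field_simp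
    rw [this, one_pow, mul_one]
  have hsplit : ‖a‖ ^ n = ‖a‖ ^ (n - k) * ‖a‖ ^ k := by rw [← pow_add]; congr 1; omega
  have h7 : L * B * (q * ‖a‖ ^ k * (d / n) ^ k) ≤ L * B * E := by
    calc L * B * (q * ‖a‖ ^ k * (d / n) ^ k)
        = ‖a‖ ^ n * q * (‖Q.eval (conj a)⁻¹‖ * (d / n) ^ k) := by rw [← h1, hsplit]; ring
      _ ≤ ‖a‖ ^ n * q * p := mul_le_mul_of_nonneg_left h6 (by positivity)
      _ = ‖a‖ ^ n * p * q := by ring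
      _ ≤ L * (Q.roots.map fun w => ‖a - w‖).prod := h
      _ ≤ L * (B * E) := mul_le_mul_of_nonneg_left h4 hL.le
      _ = L * B * E := by ring
  exact le_of_mul_le_mul_left h7 (by positivity)

theorem sum_one_sub_sq_derivZeros_nonneg (k n : ℕ) :
    0 ≤ ((derivZeros k z n).map fun w => 1 - ‖w‖ ^ 2).sum := by
  refine Multiset.sum_nonneg ?_
  simp only [Multiset.mem_map]
  rintro _ ⟨w, hw, rfl⟩
  have := norm_le_one_of_mem_derivZeros hz k n w hw
  nlinarith [norm_nonneg w]

/-- A polynomial lower bound for `P_n^(k) / P_n` at one point of the punctured disk forces the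
zeros of `P_n^(k)` to approach the unit circle on average. -/
theorem tendsto_average_one_sub_sq_derivZeros {a : ℂ} (ha0 : a ≠ 0) (ha1 : ‖a‖ < 1) {k p : ℕ}
    {c : ℝ} (hc : 0 < c)
    (h : ∀ᶠ n : ℕ in atTop, ‖(polyOfZeros z n).eval a‖ * (c / n ^ p)
      ≤ ‖(derivative^[k] (polyOfZeros z n)).eval a‖) :
    Tendsto (fun n : ℕ => (((n - k : ℕ) : ℝ))⁻¹ *
      ((derivZeros k z n).map fun w => 1 - ‖w‖ ^ 2).sum) atTop (𝓝 0) := by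
  have hapos : 0 < ‖a‖ := norm_pos_iff.2 ha0
  have hd : 0 < ‖a‖⁻¹ - 1 := by linarith [(one_lt_inv₀ hapos).2 ha1]
  have hκ : 0 < (1 - ‖a‖ ^ 2) / 8 := by nlinarith
  set e := c * ‖a‖ ^ k * (‖a‖⁻¹ - 1) ^ k with he
  have hepos : 0 < e := by positivity
  set κ := (1 - ‖a‖ ^ 2) / 8
  have hlog : Tendsto (fun n : ℕ => Real.log n / (n : ℝ)) atTop (𝓝 0) :=
    Real.isLittleO_log_id_atTop.tendsto_div_nhds_zero.comp tendsto_natCast_atTop_atTop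
  have hinv : Tendsto (fun n : ℕ => (n : ℝ)⁻¹) atTop (𝓝 0) :=
    tendsto_inv_atTop_zero.comp tendsto_natCast_atTop_atTop
  have hub : Tendsto (fun n : ℕ => 2 * κ⁻¹ * ((p + k : ℕ) * (Real.log n / (n : ℝ))
      - Real.log e * (n : ℝ)⁻¹)) atTop (𝓝 0) := by
    have := ((hlog.const_mul ((p + k : ℕ) : ℝ)).sub (hinv.const_mul (Real.log e))).const_mul
      (2 * κ⁻¹)
    simpa using this
  refine tendsto_of_tendsto_of_tendsto_of_le_of_le' tendsto_const_nhds hub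
    (Eventually.of_forall fun n => mul_nonneg (by positivity)
      (sum_one_sub_sq_derivZeros_nonneg hz k n)) ?_
  -- `n ≥ 2k` gives `1 / (n - k) ≤ 2 / n`; taking logarithms bounds the sum by `O(log n)`.
  filter_upwards [h, eventually_gt_atTop k, eventually_ge_atTop (2 * k)] with n hn hkn h2k
  have h1 := le_exp_neg_sum_derivZeros hz ha0 ha1 hkn hn
  have hnpos : (0 : ℝ) < n := by exact_mod_cast (by omega : 0 < n)
  have hS := sum_one_sub_sq_derivZeros_nonneg hz k n
  set S := ((derivZeros k z n).map fun w => 1 - ‖w‖ ^ 2).sum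
  have h2 : c / (n : ℝ) ^ p * ‖a‖ ^ k * ((‖a‖⁻¹ - 1) / n) ^ k = e / (n : ℝ) ^ (p + k) := by
    rw [he, div_pow, pow_add]; field_simp
  rw [h2] at h1
  have h3 := Real.log_le_log (by positivity) h1
  rw [Real.log_exp, Real.log_div hepos.ne' (by positivity), Real.log_pow] at h3
  change _ ≤ -(κ * S) at h3
  have h4 : S ≤ κ⁻¹ * ((p + k : ℕ) * Real.log n - Real.log e) := by
    rw [inv_mul_eq_div, le_div_iff₀ hκ]
    linarith
  have h5 : (((n - k : ℕ) : ℝ))⁻¹ ≤ 2 * (n : ℝ)⁻¹ := by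
    have h6 : (n : ℝ) / 2 ≤ ((n - k : ℕ) : ℝ) := by
      have : (n : ℝ) ≤ 2 * ((n - k : ℕ) : ℝ) := by exact_mod_cast (by omega : n ≤ 2 * (n - k))
      linarith
    calc (((n - k : ℕ) : ℝ))⁻¹ ≤ ((n : ℝ) / 2)⁻¹ := inv_anti₀ (by positivity) h6
      _ = 2 * (n : ℝ)⁻¹ := by rw [inv_div]; ring
  calc (((n - k : ℕ) : ℝ))⁻¹ * S ≤ 2 * (n : ℝ)⁻¹ * S := mul_le_mul_of_nonneg_right h5 hS
    _ ≤ 2 * (n : ℝ)⁻¹ * (κ⁻¹ * ((p + k : ℕ) * Real.log n - Real.log e)) :=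
        mul_le_mul_of_nonneg_left h4 (by positivity)
    _ = _ := by ring

end

/-! ### Weak convergence from holomorphic moments. -/

theorem integrable_of_continuous_of_ae_norm_le_one {ν : Measure ℂ} [IsFiniteMeasure ν]
    (hν : ∀ᵐ w ∂ν, ‖w‖ ≤ 1) {E : Type*} [NormedAddCommGroup E] [SecondCountableTopology E]
    {f : ℂ → E} (hf : Continuous f) : Integrable f ν := by
  obtain ⟨C, hC⟩ := (isCompact_closedBall (0 : ℂ) 1).exists_bound_of_continuousOn
    hf.continuousOn
  refine Integrable.of_bound hf.aestronglyMeasurable C ?_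
  filter_upwards [hν] with w hw
  exact hC w (by simpa using hw)

/-- The product is `w ^ d * ‖w‖ ^ (2 * b)`, and Bernoulli bounds `1 - ‖w‖ ^ (2 * b)`. Near the
circle, mixed moments thus reduce to holomorphic ones. -/
theorem norm_pow_mul_conj_pow_sub_le {w : ℂ} (hw : ‖w‖ ≤ 1) (d b : ℕ) :
    ‖w ^ (d + b) * conj w ^ b - w ^ d‖ ≤ b * (1 - ‖w‖ ^ 2) := by
  have h1 : w ^ (d + b) * conj w ^ b - w ^ d = -(w ^ d * ((1 - (‖w‖ ^ 2) ^ b : ℝ) : ℂ)) := by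
    have : ((1 - (‖w‖ ^ 2) ^ b : ℝ) : ℂ) = 1 - w ^ b * conj w ^ b := by
      rw [← mul_pow, Complex.mul_conj']; push_cast; ring
    rw [this]; ring
  have h2 : 0 ≤ 1 - ‖w‖ ^ 2 := by nlinarith [norm_nonneg w]
  have h3 : 1 + (b : ℝ) * (‖w‖ ^ 2 - 1) ≤ (‖w‖ ^ 2) ^ b := by
    have := one_add_mul_le_pow (a := ‖w‖ ^ 2 - 1) (by nlinarith [sq_nonneg ‖w‖]) b
    simpa using this
  have h4 : (‖w‖ ^ 2) ^ b ≤ 1 := pow_le_one₀ (by positivity) (by linarith)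
  rw [h1, norm_neg, norm_mul, norm_pow, Complex.norm_real, Real.norm_eq_abs,
    abs_of_nonneg (by linarith)]
  calc ‖w‖ ^ d * (1 - (‖w‖ ^ 2) ^ b) ≤ 1 * (1 - (‖w‖ ^ 2) ^ b) :=
        mul_le_mul_of_nonneg_right (pow_le_one₀ (norm_nonneg w) hw) (by linarith)
    _ ≤ _ := by linarith

section
variable {μ : ProbabilityMeasure ℂ} {ν : ℕ → ProbabilityMeasure ℂ}

theorem tendsto_integral_pow_mul_conj_pow (hμ : ∀ᵐ w ∂(μ : Measure ℂ), ‖w‖ = 1)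
    (hν : ∀ n, ∀ᵐ w ∂(ν n : Measure ℂ), ‖w‖ ≤ 1)
    (hmom : ∀ m : ℕ, Tendsto (fun n => ∫ w, w ^ m ∂(ν n : Measure ℂ)) atTop
      (𝓝 (∫ w, w ^ m ∂(μ : Measure ℂ))))
    (hsq : Tendsto (fun n => ∫ w, (1 - ‖w‖ ^ 2) ∂(ν n : Measure ℂ)) atTop (𝓝 0)) (a b : ℕ) :
    Tendsto (fun n => ∫ w, w ^ a * conj w ^ b ∂(ν n : Measure ℂ)) atTop
      (𝓝 (∫ w, w ^ a * conj w ^ b ∂(μ : Measure ℂ))) := by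
  have key : ∀ d b : ℕ, Tendsto (fun n => ∫ w, w ^ (d + b) * conj w ^ b ∂(ν n : Measure ℂ)) atTop
      (𝓝 (∫ w, w ^ (d + b) * conj w ^ b ∂(μ : Measure ℂ))) := by
    intro d b
    have e1 : ∫ w, w ^ (d + b) * conj w ^ b ∂(μ : Measure ℂ) = ∫ w, w ^ d ∂(μ : Measure ℂ) := by
      refine integral_congr_ae ?_
      filter_upwards [hμ] with w hw
      have := norm_pow_mul_conj_pow_sub_le hw.le d b
      rw [hw] at this
      rw [← sub_eq_zero, ← norm_le_zero_iff]
      simpa using this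
    rw [e1]
    have e2 : Tendsto (fun n => (∫ w, w ^ (d + b) * conj w ^ b ∂(ν n : Measure ℂ))
        - ∫ w, w ^ d ∂(ν n : Measure ℂ)) atTop (𝓝 0) := by
      refine squeeze_zero_norm (fun n => ?_) (by simpa using hsq.const_mul (b : ℝ))
      rw [← integral_sub
        (integrable_of_continuous_of_ae_norm_le_one (hν n) (by fun_prop))
        (integrable_of_continuous_of_ae_norm_le_one (hν n) (by fun_prop)),
        ← integral_const_mul]
      refine norm_integral_le_of_norm_le
        (integrable_of_continuous_of_ae_norm_le_one (hν n) (by fun_prop)) ?_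
      filter_upwards [hν n] with w hw using norm_pow_mul_conj_pow_sub_le hw d b
    simpa using e2.add (hmom d)
  rcases le_total b a with hab | hab
  · obtain ⟨d, rfl⟩ := Nat.exists_eq_add_of_le' hab
    exact key d b
  · obtain ⟨d, rfl⟩ := Nat.exists_eq_add_of_le' hab
    have h := (Complex.continuous_conj.tendsto _).comp (key d a)
    have e : ∀ ρ : Measure ℂ, conj (∫ w, w ^ (d + a) * conj w ^ a ∂ρ)
        = ∫ w, w ^ a * conj w ^ (d + a) ∂ρ := fun ρ => by
      rw [← integral_conj]
      congr 1; ext w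
      simp [mul_comm]
    simpa only [Function.comp_def, e] using h

/-- Stone–Weierstrass on the closed disk: `h` is a polynomial in `w` and `conj w`, whose integrals
converge by linearity. -/
theorem exists_continuous_near_on_closedBall (hμ : ∀ᵐ w ∂(μ : Measure ℂ), ‖w‖ = 1)
    (hν : ∀ n, ∀ᵐ w ∂(ν n : Measure ℂ), ‖w‖ ≤ 1)
    (hmom : ∀ m : ℕ, Tendsto (fun n => ∫ w, w ^ m ∂(ν n : Measure ℂ)) atTop
      (𝓝 (∫ w, w ^ m ∂(μ : Measure ℂ))))
    (hsq : Tendsto (fun n => ∫ w, (1 - ‖w‖ ^ 2) ∂(ν n : Measure ℂ)) atTop (𝓝 0))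
    {g : ℂ → ℂ} (hg : Continuous g) {ε : ℝ} (hε : 0 < ε) :
    ∃ h : ℂ → ℂ, Continuous h ∧ (∀ w, ‖w‖ ≤ 1 → ‖g w - h w‖ ≤ ε) ∧
      Tendsto (fun n => ∫ w, h w ∂(ν n : Measure ℂ)) atTop
        (𝓝 (∫ w, h w ∂(μ : Measure ℂ))) := by
  let D : Set ℂ := Metric.closedBall 0 1
  have : CompactSpace D := isCompact_iff_compactSpace.1 (isCompact_closedBall _ _)
  let idD : C(D, ℂ) := ContinuousMap.restrict D (ContinuousMap.id ℂ)
  have hμ' : ∀ᵐ w ∂(μ : Measure ℂ), ‖w‖ ≤ 1 := hμ.mono fun w hw => hw.le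
  have hspan : ∀ p ∈ Submodule.span ℂ (Submonoid.closure {idD, star idD} : Set C(D, ℂ)),
      ∃ h : ℂ → ℂ, Continuous h ∧ (∀ w : D, h w = p w) ∧
      Tendsto (fun n => ∫ w, h w ∂(ν n : Measure ℂ)) atTop
        (𝓝 (∫ w, h w ∂(μ : Measure ℂ))) := by
    intro p hp
    induction hp using Submodule.span_induction with
    | mem p hp =>
      obtain ⟨a, b, rfl⟩ := (Submonoid.mem_closure_pair _ _ _).1 hp
      exact ⟨fun w => w ^ a * conj w ^ b, by fun_prop, fun w => by simp [idD],
        tendsto_integral_pow_mul_conj_pow hμ hν hmom hsq a b⟩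
    | zero => exact ⟨0, continuous_zero, fun w => by simp, by simp⟩
    | add p q _ _ hp hq =>
      obtain ⟨h₁, c₁, e₁, t₁⟩ := hp
      obtain ⟨h₂, c₂, e₂, t₂⟩ := hq
      refine ⟨fun w => h₁ w + h₂ w, c₁.add c₂, fun w => by simp [e₁, e₂], ?_⟩
      have := t₁.add t₂
      rw [← integral_add (integrable_of_continuous_of_ae_norm_le_one hμ' c₁)
        (integrable_of_continuous_of_ae_norm_le_one hμ' c₂)] at this
      refine this.congr fun n => ?_
      rw [integral_add (integrable_of_continuous_of_ae_norm_le_one (hν n) c₁)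
        (integrable_of_continuous_of_ae_norm_le_one (hν n) c₂)]
    | smul r p _ hp =>
      obtain ⟨h, c, e, t⟩ := hp
      refine ⟨fun w => r • h w, c.const_smul r, fun w => by simp [e], ?_⟩
      simpa only [integral_smul] using t.const_smul r
  let f : C(D, ℂ) := ContinuousMap.restrict D ⟨g, hg⟩
  have hf : f ∈ closure (Submodule.span ℂ (Submonoid.closure {idD, star idD} : Set C(D, ℂ)) :
      Set C(D, ℂ)) := by
    have h1 : f ∈ StarAlgebra.elemental ℂ idD := by
      rw [show idD = ContinuousMap.restrict D (ContinuousMap.id ℂ) from rfl,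
        ContinuousMap.elemental_id_eq_top]
      trivial
    have h2 : f ∈ closure (StarAlgebra.adjoin ℂ ({idD} : Set C(D, ℂ)) : Set C(D, ℂ)) := h1
    have h3 : (StarAlgebra.adjoin ℂ ({idD} : Set C(D, ℂ)) : Set C(D, ℂ))
        = (Submodule.span ℂ (Submonoid.closure {idD, star idD} : Set C(D, ℂ)) : Set C(D, ℂ)) := by
      rw [← Algebra.adjoin_eq_span, Subalgebra.coe_toSubmodule]
      change ((StarAlgebra.adjoin ℂ ({idD} : Set C(D, ℂ))).toSubalgebra : Set C(D, ℂ)) = _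
      rw [StarAlgebra.adjoin_toSubalgebra]
      rw [Set.star_singleton, Set.singleton_union]
    rwa [← h3]
  obtain ⟨p, hp, hfp⟩ := Metric.mem_closure_iff.1 hf ε hε
  obtain ⟨h, hc, he, ht⟩ := hspan p hp
  refine ⟨h, hc, fun w hw => ?_, ht⟩
  have hwD : w ∈ D := by simpa [D] using hw
  have := (ContinuousMap.dist_apply_le_dist (f := f) (g := p) ⟨w, hwD⟩).trans hfp.le
  rw [dist_eq_norm, ← he ⟨w, hwD⟩] at this
  exact this

/-- Measures on the closed unit disk that concentrate on the unit circle and whose holomorphic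
moments converge to those of a measure on the circle converge weakly to it. -/
theorem tendsto_of_tendsto_moments (hμ : ∀ᵐ w ∂(μ : Measure ℂ), ‖w‖ = 1)
    (hν : ∀ n, ∀ᵐ w ∂(ν n : Measure ℂ), ‖w‖ ≤ 1)
    (hmom : ∀ m : ℕ, Tendsto (fun n => ∫ w, w ^ m ∂(ν n : Measure ℂ)) atTop
      (𝓝 (∫ w, w ^ m ∂(μ : Measure ℂ))))
    (hsq : Tendsto (fun n => ∫ w, (1 - ‖w‖ ^ 2) ∂(ν n : Measure ℂ)) atTop (𝓝 0)) :
    Tendsto ν atTop (𝓝 μ) := by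
  rw [ProbabilityMeasure.tendsto_iff_forall_integral_tendsto]
  intro g
  have hμ' : ∀ᵐ w ∂(μ : Measure ℂ), ‖w‖ ≤ 1 := hμ.mono fun w hw => hw.le
  have hgc : Continuous fun w => (g w : ℂ) := Complex.continuous_ofReal.comp g.continuous
  have hc : Tendsto (fun n => ∫ w, (g w : ℂ) ∂(ν n : Measure ℂ)) atTop
      (𝓝 (∫ w, (g w : ℂ) ∂(μ : Measure ℂ))) := by
    rw [Metric.tendsto_atTop]
    intro ε hε
    obtain ⟨h, hhc, hgh, ht⟩ := exists_continuous_near_on_closedBall hμ hν hmom hsq hgc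
      (ε := ε / 4) (by positivity)
    have hdiff : ∀ ρ : ProbabilityMeasure ℂ, (∀ᵐ w ∂(ρ : Measure ℂ), ‖w‖ ≤ 1) →
        dist (∫ w, (g w : ℂ) ∂(ρ : Measure ℂ)) (∫ w, h w ∂(ρ : Measure ℂ)) ≤ ε / 4 := by
      intro ρ hρ
      rw [dist_eq_norm, ← integral_sub (integrable_of_continuous_of_ae_norm_le_one hρ hgc)
        (integrable_of_continuous_of_ae_norm_le_one hρ hhc)]
      have := norm_integral_le_of_norm_le_const (μ := (ρ : Measure ℂ))
        (f := fun w => (g w : ℂ) - h w) (C := ε / 4) (hρ.mono fun w hw => hgh w hw)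
      simpa using this
    obtain ⟨N, hN⟩ := Metric.tendsto_atTop.1 ht (ε / 4) (by positivity)
    refine ⟨N, fun n hn => ?_⟩
    have h1 := hdiff (ν n) (hν n)
    have h2 := hdiff μ hμ'
    rw [dist_comm] at h2
    have h3 := dist_triangle4 (∫ w, (g w : ℂ) ∂(ν n : Measure ℂ)) (∫ w, h w ∂(ν n : Measure ℂ))
      (∫ w, h w ∂(μ : Measure ℂ)) (∫ w, (g w : ℂ) ∂(μ : Measure ℂ))
    linarith [hN n hn]
  have := (Complex.continuous_re.tendsto _).comp hc
  simpa only [Function.comp_def, integral_complex_ofReal, Complex.ofReal_re] using this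

end

/-! ### The deterministic convergence criterion. -/

theorem integral_sum_map_dirac {E : Type*} [NormedAddCommGroup E] [NormedSpace ℝ E]
    [SecondCountableTopology E] [CompleteSpace E]
    {f : ℂ → E} (hf : Continuous f) (s : Multiset ℂ) :
    Integrable f (s.map Measure.dirac).sum ∧
      ∫ w, f w ∂(s.map Measure.dirac).sum = (s.map f).sum := by
  induction s using Multiset.induction_on with
  | empty => simp
  | cons a s ih =>
    have ha : Integrable f (Measure.dirac a) :=
      integrable_dirac' hf.stronglyMeasurable (by simp)
    simp only [Multiset.map_cons, Multiset.sum_cons]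
    exact ⟨ha.add_measure ih.1, by rw [integral_add_measure ha ih.1, ih.2, integral_dirac]⟩

theorem ae_sum_map_dirac (s : Multiset ℂ) {p : ℂ → Prop} (hp : MeasurableSet {w | p w})
    (h : ∀ w ∈ s, p w) : ∀ᵐ w ∂(s.map Measure.dirac).sum, p w := by
  induction s using Multiset.induction_on with
  | empty => simp
  | cons a s ih =>
    simp only [Multiset.map_cons, Multiset.sum_cons]
    rw [ae_add_measure_iff]
    exact ⟨(ae_dirac_iff hp).2 (h a (Multiset.mem_cons_self a s)),
      ih fun w hw => h w (Multiset.mem_cons_of_mem hw)⟩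

theorem integral_derivZerosMeasure {E : Type*} [NormedAddCommGroup E] [NormedSpace ℝ E]
    [SecondCountableTopology E] [CompleteSpace E]
    {f : ℂ → E} (hf : Continuous f) (k : ℕ) (z : ℕ → ℂ) (n : ℕ) :
    ∫ w, f w ∂(derivZerosMeasure k z n)
      = (((n - k : ℕ) : ℝ))⁻¹ • ((derivZeros k z n).map f).sum := by
  rw [derivZerosMeasure, integral_smul_measure, (integral_sum_map_dirac hf _).2,
    ENNReal.toReal_inv, ENNReal.toReal_natCast]

/-- Randomness has only to supply `hmom` and the lower bound `h` at a single point `a`. -/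
theorem tendsto_empiricalMeasure {z : ℕ → ℂ} (hz : ∀ i, ‖z i‖ = 1) {μ : ProbabilityMeasure ℂ}
    (hμ : ∀ᵐ w ∂(μ : Measure ℂ), ‖w‖ = 1)
    (hmom : ∀ m : ℕ, Tendsto (fun n : ℕ => (n : ℝ)⁻¹ • ∑ i ∈ Finset.range n, z i ^ m) atTop
      (𝓝 (∫ w, w ^ m ∂(μ : Measure ℂ))))
    {a : ℂ} (ha0 : a ≠ 0) (ha1 : ‖a‖ < 1) {k p : ℕ} {c : ℝ} (hc : 0 < c)
    (h : ∀ᶠ n : ℕ in atTop, ‖(polyOfZeros z n).eval a‖ * (c / n ^ p)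
      ≤ ‖(derivative^[k] (polyOfZeros z n)).eval a‖)
    (hk : ∀ m : ℕ, k < m + k + 1) :
    Tendsto (fun m : ℕ => empiricalMeasure k z (m + k + 1) (hk m)) atTop (𝓝 μ) := by
  have hshift : Tendsto (fun m : ℕ => m + k + 1) atTop atTop :=
    tendsto_atTop_mono (fun m => by omega : ∀ m, m ≤ m + k + 1) tendsto_id
  refine tendsto_of_tendsto_moments hμ (fun n => ?_) (fun m => ?_) ?_
  · change ∀ᵐ w ∂(derivZerosMeasure k z (n + k + 1)), ‖w‖ ≤ 1
    exact Measure.ae_smul_measure (ae_sum_map_dirac _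
      (measurableSet_le measurable_norm measurable_const)
      (norm_le_one_of_mem_derivZeros hz k _)) _
  · have key : Tendsto (fun n : ℕ => (((n - k : ℕ) : ℝ))⁻¹ •
        ((derivZeros k z n).map fun w => w ^ m).sum) atTop
        (𝓝 (∫ w, w ^ m ∂(μ : Measure ℂ))) := by
      have hsub : Tendsto (fun n : ℕ => n - k) atTop atTop := tendsto_sub_atTop_nat k
      have hinv : Tendsto (fun n : ℕ => (((n - k : ℕ) : ℝ))⁻¹) atTop (𝓝 0) :=
        tendsto_inv_atTop_zero.comp (tendsto_natCast_atTop_atTop.comp hsub)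
      have h1 : Tendsto (fun n : ℕ => (((n - k : ℕ) : ℝ))⁻¹ •
          (((derivZeros k z n).map fun w => w ^ m).sum - ∑ i ∈ Finset.range n, z i ^ m)) atTop
          (𝓝 0) := by
        refine squeeze_zero_norm' ?_ (by simpa using hinv.mul_const ((k : ℝ) * (8 * 2 ^ m)))
        filter_upwards [eventually_ge_atTop k] with n hn
        rw [norm_smul, Real.norm_of_nonneg (by positivity)]
        exact mul_le_mul_of_nonneg_left (norm_sum_pow_derivZeros_sub_le hz m k n hn)
          (by positivity)
      have h2 : Tendsto (fun n : ℕ => 1 + (k : ℝ) * (((n - k : ℕ) : ℝ))⁻¹) atTop (𝓝 1) := by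
        simpa using (hinv.const_mul (k : ℝ)).const_add 1
      have h3 := h1.add (h2.smul (hmom m))
      rw [zero_add, one_smul] at h3
      refine h3.congr' ?_
      filter_upwards [eventually_gt_atTop k] with n hn
      have hpos : (0 : ℝ) < ((n - k : ℕ) : ℝ) := by exact_mod_cast Nat.sub_pos_of_lt hn
      have hcast : ((n - k : ℕ) : ℝ) = n - k := by push_cast [hn.le]; ring
      have hn0 : (0 : ℝ) < n := by exact_mod_cast (by omega : 0 < n)
      have e : (1 + (k : ℝ) * (((n - k : ℕ) : ℝ))⁻¹) * (n : ℝ)⁻¹ = (((n - k : ℕ) : ℝ))⁻¹ := by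
        field_simp
        rw [hcast]; ring
      rw [smul_smul, e, smul_sub, sub_add_cancel]
    refine (key.comp hshift).congr fun n => ?_
    exact (integral_derivZerosMeasure (by fun_prop) k z (n + k + 1)).symm
  · refine ((tendsto_average_one_sub_sq_derivZeros hz ha0 ha1 hc h).comp hshift).congr
      fun n => ?_
    exact (integral_derivZerosMeasure (f := fun w : ℂ => 1 - ‖w‖ ^ 2) (by fun_prop) k z
      (n + k + 1)).symm

/-! ### The ratio `P_n^(k)(a) / P_n(a)` and its asymptotics. -/

theorem iterate_derivative_mul_X_sub_C (p : ℂ[X]) (c : ℂ) (k : ℕ) :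
    derivative^[k + 1] (p * (X - C c))
      = derivative^[k + 1] p * (X - C c) + (k + 1 : ℕ) • derivative^[k] p := by
  induction k with
  | zero => simp
  | succ k ih =>
    rw [Function.iterate_succ_apply', ih, derivative_add, derivative_mul, derivative_smul,
      ← Function.iterate_succ_apply' derivative (k + 1) p,
      ← Function.iterate_succ_apply' derivative k p]
    simp only [derivative_sub, derivative_X, derivative_C, sub_zero, mul_one, nsmul_eq_mul,
      Nat.cast_add, Nat.cast_one]
    ring

theorem polyOfZeros_succ (z : ℕ → ℂ) (n : ℕ) :
    polyOfZeros z (n + 1) = polyOfZeros z n * (X - C (z n)) :=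
  Finset.prod_range_succ _ _

theorem eval_iterate_derivative_polyOfZeros_succ (z : ℕ → ℂ) (a : ℂ) (k n : ℕ) :
    (derivative^[k + 1] (polyOfZeros z (n + 1))).eval a
      = (derivative^[k + 1] (polyOfZeros z n)).eval a * (a - z n)
        + (k + 1) * (derivative^[k] (polyOfZeros z n)).eval a := by
  rw [polyOfZeros_succ, iterate_derivative_mul_X_sub_C]
  simp

theorem eval_polyOfZeros_ne_zero {z : ℕ → ℂ} {a : ℂ} (hz : ∀ i, z i ≠ a) (n : ℕ) :
    (polyOfZeros z n).eval a ≠ 0 := by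
  rw [polyOfZeros, eval_prod, Finset.prod_ne_zero_iff]
  intro i _
  simpa [sub_eq_zero] using (hz i).symm

/-- The ratio `P_n^(k)(a) / P_n(a)`. -/
noncomputable def derivRatio (a : ℂ) (k n : ℕ) (z : ℕ → ℂ) : ℂ :=
  (derivative^[k] (polyOfZeros z n)).eval a / (polyOfZeros z n).eval a

theorem derivRatio_zero_left {z : ℕ → ℂ} {a : ℂ} (hz : ∀ i, z i ≠ a) (n : ℕ) :
    derivRatio a 0 n z = 1 := div_self (eval_polyOfZeros_ne_zero hz n)

theorem derivRatio_succ_zero (z : ℕ → ℂ) (a : ℂ) (k : ℕ) : derivRatio a (k + 1) 0 z = 0 := by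
  simp [derivRatio, polyOfZeros]

theorem derivRatio_succ_succ {z : ℕ → ℂ} {a : ℂ} (hz : ∀ i, z i ≠ a) (k n : ℕ) :
    derivRatio a (k + 1) (n + 1) z
      = derivRatio a (k + 1) n z + (k + 1) * derivRatio a k n z * (1 / (a - z n)) := by
  have h0 := eval_polyOfZeros_ne_zero hz n
  have h1 : a - z n ≠ 0 := sub_ne_zero.2 (hz n).symm
  simp only [derivRatio]
  rw [eval_iterate_derivative_polyOfZeros_succ, polyOfZeros_succ, eval_mul]
  simp only [eval_sub, eval_X, eval_C]
  field_simp

/-- The binomial remainder has nonnegative coefficients, so its value at `(A, B)` dominates. -/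
theorem norm_add_pow_sub_sub_le {s x : ℂ} {A B : ℝ} (hs : ‖s‖ ≤ A) (hx : ‖x‖ ≤ B) (k : ℕ) :
    ‖(s + x) ^ (k + 1) - s ^ (k + 1) - (k + 1) * s ^ k * x‖
      ≤ (A + B) ^ (k + 1) - A ^ (k + 1) - (k + 1) * A ^ k * B := by
  have hA : 0 ≤ A := (norm_nonneg s).trans hs
  have hB : 0 ≤ B := (norm_nonneg x).trans hx
  induction k with
  | zero => simp
  | succ k ih =>
    have e1 : (s + x) ^ (k + 1 + 1) - s ^ (k + 1 + 1) - ((k + 1 : ℕ) + 1) * s ^ (k + 1) * x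
        = (s + x) * ((s + x) ^ (k + 1) - s ^ (k + 1) - (k + 1) * s ^ k * x)
          + (k + 1) * s ^ k * x ^ 2 := by push_cast; ring
    have e2 : (A + B) ^ (k + 1 + 1) - A ^ (k + 1 + 1) - ((k + 1 : ℕ) + 1) * A ^ (k + 1) * B
        = (A + B) * ((A + B) ^ (k + 1) - A ^ (k + 1) - (k + 1) * A ^ k * B)
          + (k + 1) * A ^ k * B ^ 2 := by push_cast; ring
    rw [e1, e2]
    refine (norm_add_le _ _).trans (add_le_add ?_ ?_)
    · rw [norm_mul]
      exact mul_le_mul ((norm_add_le _ _).trans (add_le_add hs hx)) ih (norm_nonneg _)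
        (by positivity)
    · rw [norm_mul, norm_mul, norm_pow, norm_pow]
      have : ‖((k : ℂ) + 1)‖ = k + 1 := by exact_mod_cast Complex.norm_natCast (k + 1)
      rw [this]
      gcongr

/-- The ratio is the sum of products of `1 / (a - z i)` over `k`-tuples of distinct indices; the
power of the sum runs over all `k`-tuples. The bound counts those with a repetition. -/
theorem norm_derivRatio_sub_sum_pow_le {z : ℕ → ℂ} {a : ℂ} (hz : ∀ i, z i ≠ a) {M : ℝ}
    (hM : ∀ i, ‖1 / (a - z i)‖ ≤ M) (n k : ℕ) :
    ‖derivRatio a k n z - (∑ i ∈ Finset.range n, 1 / (a - z i)) ^ k‖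
      ≤ M ^ k * ((n : ℝ) ^ k - n.descFactorial k) := by
  have hM0 : 0 ≤ M := (norm_nonneg _).trans (hM 0)
  induction n generalizing k with
  | zero =>
    cases k with
    | zero => simp [derivRatio_zero_left hz]
    | succ k => simp [derivRatio_succ_zero]
  | succ n ih =>
    cases k with
    | zero => simp [derivRatio_zero_left hz]
    | succ k =>
      have h1 := ih (k + 1)
      have h2 := ih k
      set s := ∑ i ∈ Finset.range n, 1 / (a - z i) with hs
      set x := 1 / (a - z n) with hx
      have hsn : ‖s‖ ≤ n * M := by
        refine (norm_sum_le _ _).trans ((Finset.sum_le_sum fun i _ => hM i).trans ?_)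
        simp
      have h3 := norm_add_pow_sub_sub_le hsn (hM n) k
      rw [derivRatio_succ_succ hz, Finset.sum_range_succ, ← hs, ← hx]
      have e : derivRatio a (k + 1) n z + (k + 1) * derivRatio a k n z * x - (s + x) ^ (k + 1)
          = (derivRatio a (k + 1) n z - s ^ (k + 1))
            + (k + 1) * (derivRatio a k n z - s ^ k) * x
            - ((s + x) ^ (k + 1) - s ^ (k + 1) - (k + 1) * s ^ k * x) := by ring
      rw [e]
      have hk1 : ‖((k : ℂ) + 1)‖ = k + 1 := by exact_mod_cast Complex.norm_natCast (k + 1)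
      have h4 : ‖(k + 1) * (derivRatio a k n z - s ^ k) * x‖
          ≤ (k + 1) * (M ^ k * ((n : ℝ) ^ k - n.descFactorial k)) * M := by
        rw [norm_mul, norm_mul, hk1]
        refine mul_le_mul (mul_le_mul_of_nonneg_left h2 (by positivity)) (hM n) (norm_nonneg _) ?_
        exact mul_nonneg (by positivity) ((norm_nonneg _).trans h2)
      refine (norm_sub_le _ _).trans ((add_le_add ((norm_add_le _ _).trans
        (add_le_add h1 h4)) h3).trans_eq ?_)
      have hdf : ((n + 1).descFactorial (k + 1) : ℝ)
          = n.descFactorial (k + 1) + (k + 1) * n.descFactorial k := by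
        rw [Nat.succ_descFactorial_succ, Nat.descFactorial_succ]
        rcases le_or_gt k n with h | h
        · push_cast [h]; ring
        · rw [Nat.descFactorial_of_lt h]; simp
      rw [hdf, show (n : ℝ) * M + M = (n + 1) * M by ring, mul_pow, mul_pow, mul_pow]
      push_cast
      ring

theorem tendsto_derivRatio_div_pow {z : ℕ → ℂ} {a : ℂ} (hz : ∀ i, z i ≠ a) {M : ℝ}
    (hM : ∀ i, ‖1 / (a - z i)‖ ≤ M) {c : ℂ}
    (hc : Tendsto (fun n : ℕ => (n : ℝ)⁻¹ • ∑ i ∈ Finset.range n, 1 / (a - z i)) atTop (𝓝 c))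
    (k : ℕ) :
    Tendsto (fun n : ℕ => derivRatio a k n z / (n : ℂ) ^ k) atTop (𝓝 (c ^ k)) := by
  have h1 : Tendsto (fun n : ℕ => M ^ k * (1 - (n.descFactorial k : ℝ) / (n : ℝ) ^ k)) atTop
      (𝓝 0) := by
    have h : Tendsto (fun n : ℕ => (n.descFactorial k : ℝ) / (n : ℝ) ^ k) atTop (𝓝 1) := by
      refine (Asymptotics.isEquivalent_iff_tendsto_one ?_).1 (isEquivalent_descFactorial k)
      filter_upwards [eventually_gt_atTop 0] with n hn
      positivity
    simpa using (h.const_sub 1).const_mul (M ^ k)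
  have h2 : Tendsto (fun n : ℕ => (derivRatio a k n z
      - (∑ i ∈ Finset.range n, 1 / (a - z i)) ^ k) / (n : ℂ) ^ k) atTop (𝓝 0) := by
    refine squeeze_zero_norm' ?_ h1
    filter_upwards [eventually_gt_atTop 0] with n hn
    have hn' : (0 : ℝ) < n := by exact_mod_cast hn
    rw [norm_div, norm_pow, Complex.norm_natCast, div_le_iff₀ (by positivity)]
    refine (norm_derivRatio_sub_sum_pow_le hz hM n k).trans_eq ?_
    field_simp
  have h3 := h2.add (hc.pow k)
  rw [zero_add] at h3
  refine h3.congr fun n => ?_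
  rw [Complex.real_smul, mul_pow, Complex.ofReal_inv, Complex.ofReal_natCast, inv_pow, sub_div,
    inv_mul_eq_div, sub_add_cancel]

theorem norm_one_div_sub_le_of_norm_eq_one {a w : ℂ} (ha : ‖a‖ < 1) (hw : ‖w‖ = 1) :
    ‖1 / (a - w)‖ ≤ 1 / (1 - ‖a‖) := by
  rw [norm_div, norm_one]
  have := norm_sub_norm_le w a
  rw [norm_sub_rev, hw] at this
  exact one_div_le_one_div_of_le (by linarith) (by linarith)

theorem ne_of_norm_eq_one {a w : ℂ} (ha : ‖a‖ < 1) (hw : ‖w‖ = 1) : w ≠ a := by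
  rintro rfl; linarith

/-- The derivative ratio is bounded below when the averages of `1 / (a - z i)` have a nonzero
limit. -/
theorem eventually_le_norm_eval_iterate_derivative {z : ℕ → ℂ} (hz : ∀ i, ‖z i‖ = 1) {a : ℂ}
    (ha : ‖a‖ < 1) {c : ℂ} (hc0 : c ≠ 0)
    (hc : Tendsto (fun n : ℕ => (n : ℝ)⁻¹ • ∑ i ∈ Finset.range n, 1 / (a - z i)) atTop (𝓝 c))
    (k : ℕ) :
    ∀ᶠ n : ℕ in atTop, ‖(polyOfZeros z n).eval a‖ * (‖c‖ ^ k / 2 / n ^ 0)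
      ≤ ‖(derivative^[k] (polyOfZeros z n)).eval a‖ := by
  have hza : ∀ i, z i ≠ a := fun i => ne_of_norm_eq_one ha (hz i)
  have h := (tendsto_derivRatio_div_pow hza
    (fun i => norm_one_div_sub_le_of_norm_eq_one ha (hz i)) hc k).norm
  have hpos : 0 < ‖c‖ ^ k := by positivity
  rw [norm_pow] at h
  filter_upwards [h.eventually_const_lt (by linarith : ‖c‖ ^ k / 2 < ‖c‖ ^ k),
    eventually_gt_atTop 0] with n hn hn0
  have h0 := norm_pos_iff.2 (eval_polyOfZeros_ne_zero hza n)
  have hn1 : (1 : ℝ) ≤ (n : ℝ) ^ k := one_le_pow₀ (by exact_mod_cast hn0)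
  rw [norm_div, norm_pow, Complex.norm_natCast, derivRatio, norm_div,
    lt_div_iff₀ (by linarith), lt_div_iff₀ h0] at hn
  -- The ratio has size about `(‖c‖ n) ^ k`, so a constant lower bound, with exponent `p = 0`,
  -- suffices.
  rw [pow_zero, div_one, mul_comm]
  refine le_trans ?_ hn.le
  rw [mul_right_comm]
  exact le_mul_of_one_le_right (by positivity) hn1

/-! ### Vanishing Cauchy transform: moments and small arcs. -/

section
variable {μ : Measure ℂ} [IsProbabilityMeasure μ]

/-- A measure on the circle whose Cauchy transform vanishes in the punctured disk has vanishing
moments. -/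
theorem integral_pow_eq_zero_of_cauchyTransform (hμ : ∀ᵐ w ∂μ, ‖w‖ = 1)
    (h : ∀ a : ℂ, a ≠ 0 → ‖a‖ < 1 → ∫ w, 1 / (a - w) ∂μ = 0) (m : ℕ) :
    ∫ w, w ^ (m + 1) ∂μ = 0 := by
  have hbound : ∀ (a : ℂ), ‖a‖ < 1 → ∀ j : ℕ, ∀ᵐ w ∂μ,
      ‖(w⁻¹) ^ j * (1 / (a - w))‖ ≤ 1 / (1 - ‖a‖) := by
    intro a ha j
    filter_upwards [hμ] with w hw
    rw [norm_mul, norm_pow, norm_inv, hw, inv_one, one_pow, one_mul]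
    exact norm_one_div_sub_le_of_norm_eq_one ha hw
  have hint : ∀ (a : ℂ), ‖a‖ < 1 → ∀ j : ℕ,
      Integrable (fun w : ℂ => (w⁻¹) ^ j * (1 / (a - w))) μ := fun a ha j =>
    Integrable.of_bound (by fun_prop) _ (hbound a ha j)
  have hint' : ∀ j : ℕ, Integrable (fun w : ℂ => (w⁻¹) ^ j) μ := fun j =>
    Integrable.of_bound (by fun_prop) 1 (hμ.mono fun w hw => by simp [hw])
  -- Integrates `1 / (a - w) = -w⁻¹ + a * w⁻¹ / (a - w)`, one step of the geometric expansion.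
  have hrec : ∀ (a : ℂ), ‖a‖ < 1 → ∀ j : ℕ, ∫ w, (w⁻¹) ^ j * (1 / (a - w)) ∂μ
      = -(∫ w, (w⁻¹) ^ (j + 1) ∂μ) + a * ∫ w, (w⁻¹) ^ (j + 1) * (1 / (a - w)) ∂μ := by
    intro a ha j
    rw [← integral_const_mul, ← integral_neg,
      ← integral_add (show Integrable (fun w : ℂ => -(w⁻¹) ^ (j + 1)) μ from (hint' _).neg)
        ((hint a ha _).const_mul a)]
    refine integral_congr_ae ?_
    filter_upwards [hμ] with w hw
    have hw0 : w ≠ 0 := by rintro rfl; simp at hw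
    have haw : a - w ≠ 0 := sub_ne_zero.2 (ne_of_norm_eq_one ha hw).symm
    rw [pow_succ]
    field_simp
    ring
  have key : ∀ j : ℕ, ∫ w, (w⁻¹) ^ (j + 1) ∂μ = 0 ∧
      ∀ a : ℂ, a ≠ 0 → ‖a‖ < 1 → ∫ w, (w⁻¹) ^ (j + 1) * (1 / (a - w)) ∂μ = 0 := by
    have step : ∀ j : ℕ, (∀ a : ℂ, a ≠ 0 → ‖a‖ < 1 → ∫ w, (w⁻¹) ^ j * (1 / (a - w)) ∂μ = 0) →
        ∫ w, (w⁻¹) ^ (j + 1) ∂μ = 0 ∧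
        ∀ a : ℂ, a ≠ 0 → ‖a‖ < 1 → ∫ w, (w⁻¹) ^ (j + 1) * (1 / (a - w)) ∂μ = 0 := by
      intro j hj
      have hc : ∫ w, (w⁻¹) ^ (j + 1) ∂μ = 0 := by
        -- The hypothesis excludes `a = 0`, so the constant term is reached by letting `a = r` tend
        -- to 0.
        have hb : ∀ r : ℝ, 0 < r → r ≤ 1 / 2 → ‖∫ w, (w⁻¹) ^ (j + 1) ∂μ‖ ≤ r * 2 := by
          intro r hr0 hr
          have hn : ‖(r : ℂ)‖ = r := by rw [Complex.norm_real, Real.norm_of_nonneg hr0.le]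
          have hr1 : ‖(r : ℂ)‖ < 1 := by rw [hn]; linarith
          have h1 := hrec r hr1 j
          rw [hj r (by exact_mod_cast hr0.ne') hr1] at h1
          have h2 : ∫ w, (w⁻¹) ^ (j + 1) ∂μ
              = r * ∫ w, (w⁻¹) ^ (j + 1) * (1 / ((r : ℂ) - w)) ∂μ := by
            linear_combination h1
          rw [h2, norm_mul, hn]
          refine mul_le_mul_of_nonneg_left ?_ hr0.le
          have h3 := norm_integral_le_of_norm_le_const (hbound r hr1 (j + 1))
          rw [hn] at h3
          have h4 : 1 / (1 - r) ≤ 2 := by rw [div_le_iff₀ (by linarith)]; linarith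
          simp only [probReal_univ, mul_one] at h3
          exact h3.trans h4
        rw [← norm_le_zero_iff]
        refine le_of_forall_pos_le_add fun ε hε => ?_
        have h1 := hb (min (ε / 2) (1 / 2)) (by positivity) (min_le_right _ _)
        linarith [min_le_left (ε / 2) (1 / 2 : ℝ)]
      refine ⟨hc, fun a ha0 ha1 => ?_⟩
      have h1 := hrec a ha1 j
      rw [hj a ha0 ha1, hc, neg_zero, zero_add] at h1
      exact (mul_eq_zero.1 h1.symm).resolve_left ha0
    intro j
    induction j with
    | zero => exact step 0 (by simpa using h)
    | succ j ih => exact step (j + 1) ih.2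
  have h1 := congrArg conj (key m).1
  rw [← integral_conj, map_zero] at h1
  rw [← h1]
  refine integral_congr_ae ?_
  filter_upwards [hμ] with w hw
  have : w⁻¹ = conj w := by
    rw [Complex.inv_def, Complex.normSq_eq_norm_sq, hw]; simp
  rw [this]
  simp

/-- The powers of `w` are orthonormal in `L²(μ)`, as for normalized arc length. -/
theorem integral_pow_mul_conj_pow_of_moments_eq_zero (hμ : ∀ᵐ w ∂μ, ‖w‖ = 1)
    (h : ∀ m : ℕ, ∫ w, w ^ (m + 1) ∂μ = 0) (m l : ℕ) :
    ∫ w, w ^ m * conj w ^ l ∂μ = if m = l then 1 else 0 := by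
  have key : ∀ d b : ℕ, ∫ w, w ^ (d + b) * conj w ^ b ∂μ = if d = 0 then 1 else 0 := by
    intro d b
    have : ∫ w, w ^ (d + b) * conj w ^ b ∂μ = ∫ w, w ^ d ∂μ := by
      refine integral_congr_ae ?_
      filter_upwards [hμ] with w hw
      have := norm_pow_mul_conj_pow_sub_le hw.le d b
      rw [hw] at this
      rw [← sub_eq_zero, ← norm_le_zero_iff]
      simpa using this
    rw [this]
    cases d with
    | zero => simp
    | succ d => simp [h d]
  rcases le_total l m with hl | hl
  · obtain ⟨d, rfl⟩ := Nat.exists_eq_add_of_le' hl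
    simp [key d l]
  · obtain ⟨d, rfl⟩ := Nat.exists_eq_add_of_le' hl
    have e : ∫ w, w ^ m * conj w ^ (d + m) ∂μ = conj (∫ w, w ^ (d + m) * conj w ^ m ∂μ) := by
      rw [← integral_conj]
      congr 1; ext w
      simp [mul_comm]
    rw [e, key d m]
    by_cases hd : d = 0 <;> simp [hd]

/-- Fejér-kernel bound for the mass of small balls. -/
theorem measureReal_closedBall_le (hμ : ∀ᵐ w ∂μ, ‖w‖ = 1)
    (h : ∀ m : ℕ, ∫ w, w ^ (m + 1) ∂μ = 0) {p : ℂ} (hp : ‖p‖ = 1) {N : ℕ} (hN : 0 < N) :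
    μ.real {w | ‖w‖ = 1 ∧ ‖w - p‖ ≤ 1 / N} ≤ 4 / N := by
  have hN' : (0 : ℝ) < N := by exact_mod_cast hN
  have hμ' : ∀ᵐ w ∂μ, ‖w‖ ≤ 1 := hμ.mono fun w hw => hw.le
  let F : ℂ → ℂ := fun w => ∑ m ∈ Finset.range N, (conj p * w) ^ m
  have hF : Continuous F := by fun_prop
  have hsq : ∫ w, ‖F w‖ ^ 2 ∂μ = N := by
    have e : ∀ w, ((‖F w‖ ^ 2 : ℝ) : ℂ) = ∑ m ∈ Finset.range N, ∑ l ∈ Finset.range N,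
        (conj p ^ m * p ^ l) * (w ^ m * conj w ^ l) := by
      intro w
      rw [Complex.ofReal_pow, ← Complex.mul_conj']
      simp only [F, map_sum, Finset.sum_mul_sum, map_pow, map_mul, Complex.conj_conj]
      refine Finset.sum_congr rfl fun m _ => Finset.sum_congr rfl fun l _ => ?_
      ring
    have hpp : conj p * p = 1 := by rw [Complex.conj_mul', hp]; simp
    have : ((∫ w, ‖F w‖ ^ 2 ∂μ : ℝ) : ℂ) = N := by
      rw [← integral_complex_ofReal]
      simp_rw [e]
      rw [integral_finsetSum _ fun m _ =>
        integrable_of_continuous_of_ae_norm_le_one hμ' (by fun_prop)]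
      have hm : ∀ m ∈ Finset.range N, ∫ w, ∑ l ∈ Finset.range N,
          (conj p ^ m * p ^ l) * (w ^ m * conj w ^ l) ∂μ = 1 := by
        intro m hm
        rw [integral_finsetSum _ fun l _ =>
          integrable_of_continuous_of_ae_norm_le_one hμ' (by fun_prop)]
        simp_rw [integral_const_mul, integral_pow_mul_conj_pow_of_moments_eq_zero hμ h]
        simp [← mul_pow, hpp, Finset.mem_range.1 hm]
      rw [Finset.sum_congr rfl hm]
      simp
    exact_mod_cast this
  -- For such `w` the `m`-th term of `F w` is within `m / N` of 1, so `F w` is within `N / 2` of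
  -- `N`. Markov with `∫ ‖F‖² = N` then yields `4 / N`.
  have hsub : {w | ‖w‖ = 1 ∧ ‖w - p‖ ≤ 1 / N} ⊆ {w | ((N : ℝ) / 2) ^ 2 ≤ ‖F w‖ ^ 2} := by
    rintro w ⟨hw, hwp⟩
    have hv : ‖conj p * w - 1‖ ≤ 1 / N := by
      have : conj p * w - 1 = conj p * (w - p) := by
        rw [mul_sub, Complex.conj_mul', hp]; simp
      rw [this, norm_mul, Complex.norm_conj, hp, one_mul]
      exact hwp
    have hv1 : ‖conj p * w‖ = 1 := by rw [norm_mul, Complex.norm_conj, hp, hw, one_mul]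
    set v := conj p * w with hvdef
    have hpow : ∀ m : ℕ, ‖v ^ m - 1‖ ≤ m * (1 / N) := by
      intro m
      induction m with
      | zero => simp
      | succ m ih =>
        have : v ^ (m + 1) - 1 = v * (v ^ m - 1) + (v - 1) := by ring
        rw [this]
        refine (norm_add_le _ _).trans ?_
        rw [norm_mul, hv1, one_mul]
        push_cast
        linarith
    have h1 : ‖F w - N‖ ≤ N / 2 := by
      have e : F w - N = ∑ m ∈ Finset.range N, (v ^ m - 1) := by simp [F, hvdef]
      rw [e]
      refine (norm_sum_le _ _).trans ((Finset.sum_le_sum fun m _ => hpow m).trans ?_)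
      rw [← Finset.sum_mul]
      have hg : (∑ m ∈ Finset.range N, (m : ℝ)) * 2 = N * (N - 1) := by
        have := Finset.sum_range_id_mul_two N
        have h2 : ((∑ i ∈ Finset.range N, i : ℕ) : ℝ) * 2 = N * ((N - 1 : ℕ) : ℝ) := by
          exact_mod_cast this
        rw [Nat.cast_sum, Nat.cast_sub hN] at h2
        simpa using h2
      rw [mul_one_div, div_le_iff₀ hN']
      nlinarith
    have h2 : (N : ℝ) / 2 ≤ ‖F w‖ := by
      have := norm_sub_norm_le (N : ℂ) (F w)
      rw [Complex.norm_natCast, norm_sub_rev] at this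
      linarith
    exact pow_le_pow_left₀ (by positivity) h2 2
  have hmk := mul_meas_ge_le_integral_of_nonneg (μ := μ) (f := fun w => ‖F w‖ ^ 2)
    (Eventually.of_forall fun w => by positivity)
    (integrable_of_continuous_of_ae_norm_le_one hμ' (by fun_prop)) (((N : ℝ) / 2) ^ 2)
  rw [hsq] at hmk
  have h3 := measureReal_mono (μ := μ) hsub
  refine h3.trans ?_
  rw [le_div_iff₀ hN']
  have h4 : (N : ℝ) * (μ.real {w | ((N : ℝ) / 2) ^ 2 ≤ ‖F w‖ ^ 2} * N) ≤ N * 4 := by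
    nlinarith
  exact le_of_mul_le_mul_left h4 hN'

/-- On the circle `w ↦ 1 / (a - w)` shrinks distances by a factor of at most 4, so the preimage of a
disk of radius `1 / (8 N)` lies within `1 / N` of any of its points on the circle. -/
theorem measure_norm_one_div_sub_lt_le (hμ : ∀ᵐ w ∂μ, ‖w‖ = 1)
    (h : ∀ m : ℕ, ∫ w, w ^ (m + 1) ∂μ = 0) {a : ℂ} (ha : ‖a‖ < 1) (c : ℂ) {N : ℕ} (hN : 0 < N) :
    μ {w | ‖1 / (a - w) - c‖ < 1 / (8 * N)} ≤ ENNReal.ofReal (4 / N) := by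
  have hN' : (0 : ℝ) < N := by exact_mod_cast hN
  by_cases hne : ∃ p : ℂ, ‖p‖ = 1 ∧ ‖1 / (a - p) - c‖ < 1 / (8 * N)
  · obtain ⟨p, hp, hpc⟩ := hne
    have hle : μ {w | ‖1 / (a - w) - c‖ < 1 / (8 * N)}
        ≤ μ {w | ‖w‖ = 1 ∧ ‖w - p‖ ≤ 1 / N} := by
      refine measure_mono_ae ?_
      filter_upwards [hμ] with w hw hwc
      refine ⟨hw, ?_⟩
      have hwc' : ‖1 / (a - w) - c‖ < 1 / (8 * N) := hwc
      have h1 : a - w ≠ 0 := sub_ne_zero.2 (ne_of_norm_eq_one ha hw).symm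
      have h2 : a - p ≠ 0 := sub_ne_zero.2 (ne_of_norm_eq_one ha hp).symm
      have e : w - p = (1 / (a - w) - 1 / (a - p)) * ((a - w) * (a - p)) := by
        field_simp
        ring
      have h3 : ‖a - w‖ ≤ 2 := by linarith [norm_sub_le a w]
      have h4 : ‖a - p‖ ≤ 2 := by linarith [norm_sub_le a p]
      have h5 : ‖1 / (a - w) - 1 / (a - p)‖ ≤ 1 / (8 * N) + 1 / (8 * N) := by
        have := norm_sub_le (1 / (a - w) - c) (1 / (a - p) - c)
        rw [sub_sub_sub_cancel_right] at this
        linarith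
      rw [e, norm_mul, norm_mul]
      calc ‖1 / (a - w) - 1 / (a - p)‖ * (‖a - w‖ * ‖a - p‖)
          ≤ (1 / (8 * N) + 1 / (8 * N)) * (2 * 2) := by gcongr
        _ = 1 / N := by field_simp; norm_num
    refine hle.trans ?_
    rw [← ofReal_measureReal]
    exact ENNReal.ofReal_le_ofReal (measureReal_closedBall_le hμ h hp hN)
  · have : μ {w | ‖1 / (a - w) - c‖ < 1 / (8 * N)} = 0 := by
      refine measure_mono_null ?_ (ae_iff.1 hμ)
      intro w hw h1
      exact hne ⟨w, h1, hw⟩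
    rw [this]
    exact zero_le

end

/-! ### Strong law, anti-concentration and Borel–Cantelli. -/

theorem measurable_derivRatio (a : ℂ) (k n : ℕ) : Measurable (derivRatio a k n) := by
  have h : ∀ n k : ℕ, Continuous fun z : ℕ → ℂ =>
      (derivative^[k] (polyOfZeros z n)).eval a := by
    intro n
    induction n with
    | zero =>
      intro k
      simp only [polyOfZeros, Finset.range_zero, Finset.prod_empty]
      exact continuous_const
    | succ n ih =>
      intro k
      cases k with
      | zero =>
        have := ih 0
        simp only [Function.iterate_zero_apply, polyOfZeros_succ, eval_mul, eval_sub, eval_X,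
          eval_C] at this ⊢
        fun_prop
      | succ k =>
        simp only [eval_iterate_derivative_polyOfZeros_succ]
        have h1 := ih (k + 1)
        have h2 := ih k
        fun_prop
  exact (h n k).measurable.div (h n 0).measurable

theorem derivRatio_congr (a : ℂ) (k : ℕ) {n : ℕ} {z z' : ℕ → ℂ} (h : ∀ i < n, z i = z' i) :
    derivRatio a k n z = derivRatio a k n z' := by
  have : polyOfZeros z n = polyOfZeros z' n :=
    Finset.prod_congr rfl fun i hi => by rw [h i (Finset.mem_range.1 hi)]
  rw [derivRatio, derivRatio, this]

section
variable {Ω : Type*} [MeasurableSpace Ω] {P : Measure Ω} {Z : ℕ → Ω → ℂ} {μ : Measure ℂ}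

theorem ae_tendsto_average (hZmeas : ∀ i, Measurable (Z i)) (hZindep : iIndepFun Z P)
    (hZlaw : ∀ i, P.map (Z i) = μ) {f : ℂ → ℂ} (hf : Measurable f) (hfi : Integrable f μ) :
    ∀ᵐ ω ∂P, Tendsto (fun n : ℕ => (n : ℝ)⁻¹ • ∑ i ∈ Finset.range n, f (Z i ω)) atTop
      (𝓝 (∫ w, f w ∂μ)) := by
  have hint : Integrable (fun ω => f (Z 0 ω)) P := by
    rw [← hZlaw 0] at hfi
    exact hfi.comp_measurable (hZmeas 0)
  have h := strong_law_ae (μ := P) (fun i ω => f (Z i ω)) hint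
    (fun i j hij => (hZindep.indepFun hij).comp hf hf)
    (fun i => IdentDistrib.comp ⟨(hZmeas i).aemeasurable, (hZmeas 0).aemeasurable,
      by rw [hZlaw, hZlaw]⟩ hf)
  have e : ∫ w, f w ∂μ = ∫ ω, f (Z 0 ω) ∂P := by
    rw [← hZlaw 0, integral_map (hZmeas 0).aemeasurable hf.aestronglyMeasurable]
  rw [e]
  exact h

theorem indepFun_comp_of_forall_lt (hZmeas : ∀ i, Measurable (Z i)) (hZindep : iIndepFun Z P)
    {φ : (ℕ → ℂ) → ℂ} (hφ : Measurable φ) {n : ℕ}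
    (hcongr : ∀ z z' : ℕ → ℂ, (∀ i < n, z i = z' i) → φ z = φ z') :
    IndepFun (fun ω => φ fun i => Z i ω) (Z n) P := by
  classical
  have h := hZindep.indepFun_finset (Finset.range n) {n} (by simp) hZmeas
  -- The filler 0 beyond index `n` is harmless, since by `hcongr` `φ` sees only the first `n` terms.
  let ext : (Finset.range n → ℂ) → ℕ → ℂ := fun v i =>
    if hi : i ∈ Finset.range n then v ⟨i, hi⟩ else 0
  have hext : Measurable ext := by
    refine measurable_pi_lambda _ fun i => ?_
    by_cases hi : i ∈ Finset.range n
    · simp only [ext, dif_pos hi]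
      exact measurable_pi_apply (⟨i, hi⟩ : Finset.range n)
    · simp only [ext, dif_neg hi]
      exact measurable_const
  have h2 := h.comp (hφ.comp hext)
    (measurable_pi_apply (X := fun _ : ({n} : Finset ℕ) => ℂ) ⟨n, Finset.mem_singleton_self n⟩)
  convert h2 using 1
  · ext ω
    refine hcongr _ _ fun i hi => ?_
    simp [ext, hi]
  · rfl

variable [IsProbabilityMeasure P] [IsProbabilityMeasure μ]

/-- By Fubini, the centre `c` may be any function of the earlier variables, which are independent of
`Z n`. -/
theorem measure_norm_one_div_sub_comp_lt_le (hZmeas : ∀ i, Measurable (Z i))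
    (hZindep : iIndepFun Z P) (hZlaw : ∀ i, P.map (Z i) = μ) {a : ℂ} {t : ℝ} {b : ℝ≥0∞}
    (hb : ∀ c : ℂ, μ {w | ‖1 / (a - w) - c‖ < t} ≤ b)
    {φ : (ℕ → ℂ) → ℂ} (hφ : Measurable φ) {n : ℕ}
    (hcongr : ∀ z z' : ℕ → ℂ, (∀ i < n, z i = z' i) → φ z = φ z') :
    P {ω | ‖1 / (a - Z n ω) - φ fun i => Z i ω‖ < t} ≤ b := by
  have hind := indepFun_comp_of_forall_lt hZmeas hZindep hφ hcongr
  have hY : Measurable fun ω => φ fun i => Z i ω := hφ.comp (measurable_pi_lambda _ hZmeas)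
  have hprod := (indepFun_iff_map_prod_eq_prod_map_map hY.aemeasurable
    (hZmeas n).aemeasurable).1 hind
  rw [hZlaw] at hprod
  let T : Set (ℂ × ℂ) := {q | ‖1 / (a - q.2) - q.1‖ < t}
  have hT : MeasurableSet T := measurableSet_lt (by fun_prop) measurable_const
  have h1 : P {ω | ‖1 / (a - Z n ω) - φ fun i => Z i ω‖ < t}
      = P.map (fun ω => (φ fun i => Z i ω, Z n ω)) T := by
    rw [Measure.map_apply (hY.prodMk (hZmeas n)) hT]; rfl
  have := Measure.isProbabilityMeasure_map (μ := P) hY.aemeasurable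
  rw [h1, hprod, Measure.prod_apply hT]
  refine (lintegral_mono (g := fun _ => b) fun y => hb y).trans ?_
  simp

/-- Anti-concentration at zero of the derivative ratio. -/
theorem measure_norm_derivRatio_lt_le (hZmeas : ∀ i, Measurable (Z i))
    (hZindep : iIndepFun Z P) (hZlaw : ∀ i, P.map (Z i) = μ) {a : ℂ}
    (hZa : ∀ᵐ ω ∂P, ∀ i, Z i ω ≠ a) {t : ℝ} (ht : 0 < t) {b : ℝ≥0∞}
    (hb : ∀ c : ℂ, μ {w | ‖1 / (a - w) - c‖ < t} ≤ b) (k n : ℕ) (hkn : k ≤ n) :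
    P {ω | ‖derivRatio a k n fun i => Z i ω‖ < t ^ k} ≤ k * b := by
  induction k generalizing n with
  | zero =>
    have : P {ω | ‖derivRatio a 0 n fun i => Z i ω‖ < t ^ 0} = 0 := by
      refine measure_mono_null ?_ (ae_iff.1 hZa)
      intro ω hω h
      have h1 : ‖derivRatio a 0 n fun i => Z i ω‖ < t ^ 0 := hω
      rw [derivRatio_zero_left h] at h1
      simp at h1
    rw [this]
    exact zero_le
  | succ k ih =>
    obtain ⟨n, rfl⟩ : ∃ n', n = n' + 1 := ⟨n - 1, by omega⟩
    -- The new ratio is affine in `1 / (a - Z n)` with slope `(k + 1) * derivRatio a k n` and root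
    -- `φ`. If it is small, either the slope is small or the variable is near `φ`; division by zero
    -- occurs only in the first case.
    let φ : (ℕ → ℂ) → ℂ := fun z =>
      -derivRatio a (k + 1) n z / ((k + 1) * derivRatio a k n z)
    have hφ : Measurable φ :=
      (measurable_derivRatio a (k + 1) n).neg.div
        ((measurable_derivRatio a k n).const_mul _)
    have h1 := ih n (by omega)
    have h2 := measure_norm_one_div_sub_comp_lt_le (n := n) hZmeas hZindep hZlaw hb hφ
      (fun z z' h => by simp only [φ, derivRatio_congr a _ h])
    have hsub : P {ω | ‖derivRatio a (k + 1) (n + 1) fun i => Z i ω‖ < t ^ (k + 1)}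
        ≤ P ({ω | ‖derivRatio a k n fun i => Z i ω‖ < t ^ k}
          ∪ {ω | ‖1 / (a - Z n ω) - φ fun i => Z i ω‖ < t}) := by
      refine measure_mono_ae ?_
      filter_upwards [hZa] with ω hω hlt
      have hlt' : ‖derivRatio a (k + 1) (n + 1) fun i => Z i ω‖ < t ^ (k + 1) := hlt
      rw [derivRatio_succ_succ hω] at hlt'
      by_cases hr : ‖derivRatio a k n fun i => Z i ω‖ < t ^ k
      · exact Or.inl hr
      · right
        push Not at hr
        change ‖1 / (a - Z n ω) - φ fun i => Z i ω‖ < t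
        simp only [φ]
        set r := derivRatio a k n fun i => Z i ω
        set R := derivRatio a (k + 1) n fun i => Z i ω
        have hk1 : ‖((k : ℂ) + 1)‖ = k + 1 := by
          exact_mod_cast Complex.norm_natCast (k + 1)
        have htk : 0 < t ^ k := pow_pos ht k
        have hr0 : r ≠ 0 := norm_pos_iff.1 (htk.trans_le hr)
        have hk0 : (k : ℂ) + 1 ≠ 0 := Nat.cast_add_one_ne_zero k
        have e : R + (k + 1) * r * (1 / (a - Z n ω))
            = ((k + 1) * r) * (1 / (a - Z n ω) - -R / ((k + 1) * r)) := by
          rw [mul_sub, mul_div_cancel₀ _ (mul_ne_zero hk0 hr0)]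
          ring
        rw [e, norm_mul, norm_mul, hk1, pow_succ] at hlt'
        have h3 : t ^ k ≤ (k + 1) * ‖r‖ := by
          have : 0 ≤ (k : ℝ) * ‖r‖ := by positivity
          linarith
        refine lt_of_mul_lt_mul_left (lt_of_le_of_lt ?_ hlt') htk.le
        exact mul_le_mul_of_nonneg_right h3 (norm_nonneg _)
    refine hsub.trans ((measure_union_le _ _).trans ((add_le_add h1 h2).trans_eq ?_))
    push_cast
    ring

theorem ae_eventually_le_norm_eval_iterate_derivative (hZmeas : ∀ i, Measurable (Z i))
    (hZindep : iIndepFun Z P) (hZlaw : ∀ i, P.map (Z i) = μ) (hμ : ∀ᵐ w ∂μ, ‖w‖ = 1)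
    (hZ1 : ∀ᵐ ω ∂P, ∀ i, ‖Z i ω‖ = 1)
    (hmom : ∀ m : ℕ, ∫ w, w ^ (m + 1) ∂μ = 0) {a : ℂ} (ha : ‖a‖ < 1) (k : ℕ) :
    ∀ᵐ ω ∂P, ∀ᶠ n : ℕ in atTop,
      ‖(polyOfZeros (fun i => Z i ω) n).eval a‖ * ((1 / 32) ^ k / n ^ (2 * k))
        ≤ ‖(derivative^[k] (polyOfZeros (fun i => Z i ω) n)).eval a‖ := by
  have hZa : ∀ᵐ ω ∂P, ∀ i, Z i ω ≠ a := hZ1.mono fun ω h i => ne_of_norm_eq_one ha (h i)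
  -- The arc scale `N = (n + k + 1) ^ 2` makes the probabilities `4 * k / N` summable. The shift by
  -- `k` ensures that the degree is at least `k`.
  let t : ℕ → ℝ := fun n => 1 / (8 * ((n + k + 1) ^ 2 : ℕ))
  have hbound : ∀ n : ℕ, P {ω | ‖derivRatio a k (n + k) fun i => Z i ω‖ < t n ^ k}
      ≤ ENNReal.ofReal (k * 4 * (1 / ((n + k + 1 : ℕ) : ℝ) ^ 2)) := by
    intro n
    refine (measure_norm_derivRatio_lt_le hZmeas hZindep hZlaw hZa (t := t n) (by positivity)
      (fun c => measure_norm_one_div_sub_lt_le hμ hmom ha c (by positivity)) k (n + k)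
      (by omega)).trans_eq ?_
    rw [← ENNReal.ofReal_natCast, ← ENNReal.ofReal_mul (by positivity)]
    congr 1
    push_cast
    ring
  have hsum : Summable fun n : ℕ => (k * 4 * (1 / ((n + k + 1 : ℕ) : ℝ) ^ 2) : ℝ) := by
    refine Summable.mul_left _ ?_
    exact (summable_nat_add_iff (f := fun n : ℕ => 1 / (n : ℝ) ^ 2) (k + 1)).2
      (Real.summable_one_div_nat_pow.2 one_lt_two)
  have hfin : ∑' n : ℕ, P {ω | ‖derivRatio a k (n + k) fun i => Z i ω‖ < t n ^ k} ≠ ∞ := by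
    refine ne_top_of_le_ne_top ?_ (ENNReal.tsum_le_tsum hbound)
    exact hsum.tsum_ofReal_ne_top
  filter_upwards [ae_eventually_notMem hfin, hZa] with ω hω hza
  have h2 : ∀ᶠ n : ℕ in atTop, ¬‖derivRatio a k ((n - k) + k) fun i => Z i ω‖
      < t (n - k) ^ k := (tendsto_sub_atTop_nat k).eventually hω
  filter_upwards [h2, eventually_ge_atTop k, eventually_gt_atTop 0] with n hn hkn hn0
  have hn1 : (1 : ℝ) ≤ n := by exact_mod_cast hn0
  rw [Nat.sub_add_cancel hkn, not_lt, derivRatio, norm_div,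
    le_div_iff₀ (norm_pos_iff.2 (eval_polyOfZeros_ne_zero hza n)), mul_comm] at hn
  refine le_trans (mul_le_mul_of_nonneg_left ?_ (norm_nonneg _)) hn
  rw [pow_mul, ← div_pow]
  refine pow_le_pow_left₀ (by positivity) ?_ k
  simp only [t]
  rw [Nat.sub_add_cancel hkn, div_div]
  push_cast
  -- The 32 comes from `8 * (n + 1) ^ 2 ≤ 32 * n ^ 2` for `n ≥ 1`.
  refine one_div_le_one_div_of_le (by positivity) ?_
  nlinarith

end

/-! ### Conclusion. -/

/-- The sequence of empirical measures is defined for `n ≥ k + 1`, so it is indexed by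
`n = m + k + 1` with `m : ℕ`. -/
theorem theorem1 (k : ℕ) (hk : 1 ≤ k)
    (μ : ProbabilityMeasure ℂ) (hμ : (μ : Measure ℂ) (Metric.sphere (0 : ℂ) 1) = 1)
    {Ω : Type*} [MeasurableSpace Ω] (P : Measure Ω) [IsProbabilityMeasure P]
    (Z : ℕ → Ω → ℂ) (hZmeas : ∀ i, Measurable (Z i))
    (hZindep : iIndepFun Z P) (hZlaw : ∀ i, P.map (Z i) = (μ : Measure ℂ)) :
    ∀ᵐ ω ∂P, Tendsto
      (fun m : ℕ => empiricalMeasure k (fun i => Z i ω) (m + k + 1) (by omega))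
      atTop (𝓝 μ) := by
  have hμ1 : ∀ᵐ w ∂(μ : Measure ℂ), ‖w‖ = 1 := by
    have h : ∀ᵐ w ∂(μ : Measure ℂ), w ∈ Metric.sphere (0 : ℂ) 1 :=
      (mem_ae_iff_prob_eq_one Metric.isClosed_sphere.measurableSet).2 hμ
    filter_upwards [h] with w hw
    simpa using hw
  have hμ1' : ∀ᵐ w ∂(μ : Measure ℂ), ‖w‖ ≤ 1 := hμ1.mono fun w hw => hw.le
  have hZ1 : ∀ᵐ ω ∂P, ∀ i, ‖Z i ω‖ = 1 := by
    rw [ae_all_iff]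
    intro i
    rw [← hZlaw i] at hμ1
    exact ae_of_ae_map (hZmeas i).aemeasurable hμ1
  have hmom : ∀ᵐ ω ∂P, ∀ m : ℕ, Tendsto
      (fun n : ℕ => (n : ℝ)⁻¹ • ∑ i ∈ Finset.range n, Z i ω ^ m) atTop
      (𝓝 (∫ w, w ^ m ∂(μ : Measure ℂ))) := by
    rw [ae_all_iff]
    intro m
    exact ae_tendsto_average hZmeas hZindep hZlaw (f := fun w => w ^ m) (by fun_prop)
      (integrable_of_continuous_of_ae_norm_le_one hμ1' (by fun_prop))
  by_cases hC : ∃ a : ℂ, a ≠ 0 ∧ ‖a‖ < 1 ∧ ∫ w, 1 / (a - w) ∂(μ : Measure ℂ) ≠ 0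
  · obtain ⟨a, ha0, ha1, hc⟩ := hC
    have hint : Integrable (fun w : ℂ => 1 / (a - w)) (μ : Measure ℂ) :=
      Integrable.of_bound
        (show Measurable fun w : ℂ => 1 / (a - w) by fun_prop).aestronglyMeasurable _
        (hμ1.mono fun w hw => norm_one_div_sub_le_of_norm_eq_one ha1 hw)
    filter_upwards [hZ1, hmom, ae_tendsto_average hZmeas hZindep hZlaw
      (f := fun w => 1 / (a - w)) (by fun_prop) hint] with ω h1 h2 h3
    exact tendsto_empiricalMeasure h1 hμ1 h2 ha0 ha1 (by positivity)
      (eventually_le_norm_eval_iterate_derivative h1 ha1 hc h3 k) _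
  · push Not at hC
    -- Any point of the punctured disk would do in this case.
    have ha : ‖(1 / 2 : ℂ)‖ < 1 := by norm_num
    filter_upwards [hZ1, hmom, ae_eventually_le_norm_eval_iterate_derivative hZmeas hZindep hZlaw
      hμ1 hZ1 (integral_pow_eq_zero_of_cauchyTransform hμ1 hC) ha k] with ω h1 h2 h3
    exact tendsto_empiricalMeasure h1 hμ1 h2 (by norm_num) ha (by positivity) h3 _
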